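/- Let $X=\mathbb{R}\times\mathbb{S}^1$ with $\mathbb{S}^1=\mathbb{R}/2\pi\mathbb{Z}$, equipped with the Lebesgue measure $dx\,dy$, and let $\mathbb{K}=\mathbb{R}$ or $\mathbb{C}$. Let $L^2_0(X)$ be the orthogonal complement in $L^2(X;\mathbb{K})$ of the functions that depend only on $x$, that is, the space of $u\in L^2(X;\mathbb{K})$ with $\int_{\mathbb{S}^1}u(x,y)\,dy=0$ for almost every $x$. For $s\in\mathbb{R}$, let $P_s$ be the operator $$P_s u=-\partial_x^2u-(x^2+s^2)\,\partial_y^2u$$ in $L^2_0(X)$, with domain $\{u\in L^2_0(X):\ \partial_x^2u\in L^2(X),\ (x^2+s^2)\,\partial_y^2u\in L^2(X)\}$, where derivatives are taken in the sense of distributions. Suppose that $s^2$ is irrational. Then: 1. every eigenvalue of $P_s$ has multiplicity exactly $2$, that is, $\dim_{\mathbb{K}}\ker(P_s-E)=2$ for every eigenvalue $E$ of $P_s$; 2. the concentration inequality for eigenfunctions holds for $P_s$ on every horizontal strip: for all real $a<b$, with $w=\mathbb{R}\times\,]a,b[\,$ regarded as a subset of $X$ (the interval being taken modulo $2\pi$),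 there is a constant $C>0$ such that for all $E\in\mathbb{K}$ and all $\phi\in\ker(P_s-E)$, $$\|\phi\|_{L^2(X)}\le C\,\|\phi\|_{L^2(w)}.$$ -/

import Mathlib

open MeasureTheory
open scoped ContDiff Manifold

noncomputable section

namespace Grushin

instance fact_two_pi_pos : Fact (0 < 2 * Real.pi) := ⟨Real.two_pi_pos⟩

/-- The infinite cylinder `X = ℝ × 𝕊¹`, with `𝕊¹ = ℝ / 2πℤ`. Its measure `volume` is the product
Lebesgue measure `dx dy`; the circle has total mass `2π`. -/
abbrev Cylinder : Type := ℝ × AddCircle (2 * Real.pi)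

/-- The universal covering `ℝ² → X`. -/
def cover (q : ℝ × ℝ) : Cylinder := (q.1, (q.2 : AddCircle (2 * Real.pi)))

/-- The Hilbert space `L²(X)`, of real (`𝕜 = ℝ`) or complex (`𝕜 = ℂ`) functions. -/
abbrev L2X (𝕜 : Type*) [RCLike 𝕜] : Type _ := Lp 𝕜 2 (volume : Measure Cylinder)

/-- The functions in `L²(X)` that depend only on `x`. -/
def dependsOnlyOnX (𝕜 : Type*) [RCLike 𝕜] : Submodule 𝕜 (L2X 𝕜) where
  carrier := {v | ∃ f : ℝ → 𝕜, ∀ᵐ p : Cylinder, v p = f p.1}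
  zero_mem' := by
    refine ⟨0, ?_⟩
    filter_upwards [Lp.coeFn_zero 𝕜 2 (volume : Measure Cylinder)] with p hp using hp
  add_mem' := by
    rintro u v ⟨f, hf⟩ ⟨g, hg⟩
    refine ⟨f + g, ?_⟩
    filter_upwards [hf, hg, Lp.coeFn_add u v] with p h1 h2 h3
    exact h3.trans (congrArg₂ (· + ·) h1 h2)
  smul_mem' := by
    rintro c u ⟨f, hf⟩
    refine ⟨c • f, ?_⟩
    filter_upwards [hf, Lp.coeFn_smul c u] with p h1 h2
    exact h2.trans (congrArg (c • ·) h1)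

/-- `L²₀(X)`: the orthogonal complement in `L²(X)` of the functions that depend only on `x`. -/
def L20 (𝕜 : Type*) [RCLike 𝕜] : Submodule 𝕜 (L2X 𝕜) := (dependsOnlyOnX 𝕜)ᗮ

/-- Test functions: smooth real functions with compact support on the cylinder. -/
structure IsTest (φ : Cylinder → ℝ) : Prop where
  smooth : ContDiff ℝ ∞ (fun q : ℝ × ℝ => φ (cover q))
  compact : HasCompactSupport φ

/-- `∂φ/∂x`. -/
def dx (φ : Cylinder → ℝ) (p : Cylinder) : ℝ := deriv (fun t : ℝ => φ (t, p.2)) p.1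

/-- `∂φ/∂y`. -/
def dy (φ : Cylinder → ℝ) (p : Cylinder) : ℝ :=
  deriv (fun t : ℝ => φ (p.1, p.2 + (t : AddCircle (2 * Real.pi)))) 0

/-- `g = ∂ₓ² u` in the sense of distributions. -/
def IsWeakDxx {𝕜 : Type*} [RCLike 𝕜] (u g : L2X 𝕜) : Prop :=
  ∀ φ : Cylinder → ℝ, IsTest φ → ∫ p, dx (dx φ) p • u p = ∫ p, φ p • g p

/-- `h = V(x) ∂_y² u` in the sense of distributions. -/
def IsWeakVDyy {𝕜 : Type*} [RCLike 𝕜] (V : C(ℝ, ℝ)) (u h : L2X 𝕜) : Prop :=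
  ∀ φ : Cylinder → ℝ, IsTest φ → ∫ p, (V p.1 * dy (dy φ) p) • u p = ∫ p, φ p • h p

/-! Elementary facts needed for the operator to be well defined. -/

theorem continuous_cover : Continuous cover :=
  continuous_fst.prodMk ((AddCircle.continuous_mk' _).comp continuous_snd)

theorem isOpenQuotientMap_cover : IsOpenQuotientMap cover :=
  IsOpenQuotientMap.id.prodMap QuotientAddGroup.isOpenQuotientMap_mk

theorem IsTest.continuous {φ : Cylinder → ℝ} (h : IsTest φ) : Continuous φ :=
  isOpenQuotientMap_cover.isQuotientMap.continuous_iff.2 h.smooth.continuous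

theorem IsTest.dx {φ : Cylinder → ℝ} (h : IsTest φ) : IsTest (dx φ) := by
  constructor
  · have hF : ContDiff ℝ ∞ (fun q : ℝ × ℝ =>
        fderiv ℝ (fun q : ℝ × ℝ => φ (cover q)) q (1, 0)) :=
      (h.smooth.fderiv_right (m := ∞) (by simp)).clm_apply contDiff_const
    convert hF using 2 with q
    have h1 : HasDerivAt (fun t : ℝ => ((t, q.2) : ℝ × ℝ)) (1, 0) q.1 :=
      (hasDerivAt_id _).prodMk (hasDerivAt_const _ _)
    have h2 := (h.smooth.differentiable (by simp) (q.1, q.2)).hasFDerivAt.comp_hasDerivAt q.1 h1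
    exact h2.deriv
  · refine h.compact.mono' ?_
    intro p hp
    by_contra hn
    apply hp
    have h0 := notMem_tsupport_iff_eventuallyEq.1 hn
    have hc : Filter.Tendsto (fun t : ℝ => ((t, p.2) : Cylinder)) (nhds p.1) (nhds p) :=
      (Continuous.prodMk_left p.2).tendsto' _ _ rfl
    have h1 : (fun t : ℝ => φ (t, p.2)) =ᶠ[nhds p.1] fun _ => (0 : ℝ) := hc.eventually h0
    have h1 := h1.deriv_eq
    simpa [Grushin.dx] using h1

theorem IsTest.dy {φ : Cylinder → ℝ} (h : IsTest φ) : IsTest (dy φ) := by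
  constructor
  · have hF : ContDiff ℝ ∞ (fun q : ℝ × ℝ =>
        fderiv ℝ (fun q : ℝ × ℝ => φ (cover q)) q (0, 1)) :=
      (h.smooth.fderiv_right (m := ∞) (by simp)).clm_apply contDiff_const
    convert hF using 2 with q
    have h1 : HasDerivAt (fun t : ℝ => ((q.1, q.2 + t) : ℝ × ℝ)) (0, 1) 0 :=
      (hasDerivAt_const _ _).prodMk ((hasDerivAt_id _).const_add _)
    have hd : HasFDerivAt (fun q : ℝ × ℝ => φ (cover q))
        (fderiv ℝ (fun q : ℝ × ℝ => φ (cover q)) q) (q.1, q.2 + 0) := by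
      simpa using (h.smooth.differentiable (by simp) q).hasFDerivAt
    have h2 := hd.comp_hasDerivAt 0 h1
    rw [← h2.deriv]
    simp [Grushin.dy, cover, Function.comp_def]
  · refine h.compact.mono' ?_
    intro p hp
    by_contra hn
    apply hp
    have h0 := notMem_tsupport_iff_eventuallyEq.1 hn
    have hc : Filter.Tendsto
        (fun t : ℝ => ((p.1, p.2 + (t : AddCircle (2 * Real.pi))) : Cylinder))
        (nhds 0) (nhds p) :=
      Continuous.tendsto' (continuous_const.prodMk
        (continuous_const.add (AddCircle.continuous_mk' _))) _ _ (by simp)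
    have h1 : (fun t : ℝ => φ (p.1, p.2 + (t : AddCircle (2 * Real.pi)))) =ᶠ[nhds 0]
        fun _ => (0 : ℝ) := hc.eventually h0
    have h1 := h1.deriv_eq
    simpa [Grushin.dy] using h1

section
variable {𝕜 : Type*} [RCLike 𝕜]

theorem L2X_locallyIntegrable (u : L2X 𝕜) : LocallyIntegrable u (volume : Measure Cylinder) :=
  (Lp.memLp u).locallyIntegrable (by norm_num)

theorem integrable_smul (u : L2X 𝕜) {f : Cylinder → ℝ} (hf : Continuous f)
    (hc : HasCompactSupport f) : Integrable (fun p => f p • u p) :=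
  (L2X_locallyIntegrable u).integrable_smul_left_of_hasCompactSupport hf hc

/-- Test functions separate the points of `L²(X)`. -/
theorem eq_of_test {g h : L2X 𝕜}
    (H : ∀ φ : Cylinder → ℝ, IsTest φ → ∫ p, φ p • g p = ∫ p, φ p • h p) : g = h := by
  rw [← sub_eq_zero]
  set w : L2X 𝕜 := g - h with hw
  have Hw : ∀ φ : Cylinder → ℝ, IsTest φ → ∫ p, φ p • w p = 0 := by
    intro φ hφ
    have h1 : (fun p => φ p • w p) =ᵐ[volume] fun p => φ p • g p - φ p • h p := by
      filter_upwards [Lp.coeFn_sub g h] with p hp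
      rw [hw, hp, Pi.sub_apply, smul_sub]
    rw [integral_congr_ae h1, integral_sub (integrable_smul g hφ.continuous hφ.compact)
      (integrable_smul h hφ.continuous hφ.compact), H φ hφ, sub_self]
  let e : Cylinder ≃ₜ ℝ × Circle := (Homeomorph.refl ℝ).prodCongr AddCircle.homeomorphCircle'
  let m : MeasurableSpace (ℝ × Circle) := borel _
  have : BorelSpace (ℝ × Circle) := ⟨rfl⟩
  let E : Cylinder ≃ᵐ ℝ × Circle := e.toMeasurableEquiv
  have hloc : LocallyIntegrable (fun q => w (e.symm q))
      (Measure.map E (volume : Measure Cylinder)) := by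
    intro q
    obtain ⟨U, hU, hi⟩ := L2X_locallyIntegrable w (e.symm q)
    refine ⟨e.symm ⁻¹' U, e.symm.continuous.continuousAt hU, ?_⟩
    have h2 := E.measurableEmbedding.integrableOn_map_iff
      (f := fun q => w (e.symm q)) (μ := volume) (s := e.symm ⁻¹' U)
    have h3 : (fun q => w (e.symm q)) ∘ E = w := by
      funext p
      exact congrArg w (e.symm_apply_apply p)
    have h4 : E ⁻¹' (e.symm ⁻¹' U) = U := by
      ext p
      exact iff_of_eq (congrArg (· ∈ U) (e.symm_apply_apply p))
    rw [h3, h4] at h2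
    exact h2.2 hi
  have key := ae_eq_zero_of_integral_contMDiff_smul_eq_zero
    (I := (𝓘(ℝ, ℝ)).prod (𝓡 1)) hloc (fun ψ hψ hc => by
      rw [E.measurableEmbedding.integral_map]
      have ht : IsTest (fun p => ψ (e p)) := by
        constructor
        · rw [← contMDiff_iff_contDiff]
          have : ContMDiff 𝓘(ℝ, ℝ × ℝ) ((𝓘(ℝ, ℝ)).prod (𝓡 1)) ∞
              (fun q : ℝ × ℝ => ((q.1, Circle.exp q.2) : ℝ × Circle)) :=
            (contMDiff_iff_contDiff.2 contDiff_fst).prodMk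
              (contMDiff_circleExp.comp (contMDiff_iff_contDiff.2 contDiff_snd))
          exact hψ.comp this
        · exact hc.comp_homeomorph e
      have h3 := Hw _ ht
      rw [← h3]
      refine integral_congr_ae (Filter.Eventually.of_forall fun p => ?_)
      exact congrArg (fun z => ψ (e p) • w z) (e.symm_apply_apply p))
  have key2 := E.measurableEmbedding.ae_map_iff.1 key
  apply Lp.ext
  filter_upwards [key2, Lp.coeFn_zero 𝕜 2 (volume : Measure Cylinder)] with p h1 h2
  rw [h2, Pi.zero_apply, ← h1]
  exact congrArg w (e.symm_apply_apply p).symm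

theorem hasCompactSupport_comp_fst {f : ℝ → ℝ} (hc : HasCompactSupport f) :
    HasCompactSupport (fun p : Cylinder => f p.1) :=
  HasCompactSupport.intro (hc.isCompact.prod (isCompact_univ (X := AddCircle (2 * Real.pi))))
    fun _ hp => image_eq_zero_of_notMem_tsupport fun h => hp ⟨h, Set.mem_univ _⟩

/-- Elements of `L²₀(X)` integrate to zero against functions of `x`. -/
theorem integral_eq_zero_of_mem_L20 {u : L2X 𝕜} (hu : u ∈ L20 𝕜) {f : ℝ → ℝ}
    (hf : Continuous f) (hc : HasCompactSupport f) : ∫ p : Cylinder, f p.1 • u p = 0 := by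
  have hm : MemLp (fun p : Cylinder => ((f p.1 : ℝ) : 𝕜)) 2 volume := by
    refine Continuous.memLp_of_hasCompactSupport (by fun_prop) ?_
    exact (hasCompactSupport_comp_fst hc).comp_left (g := fun r : ℝ => (r : 𝕜)) (by simp)
  have hv : hm.toLp ∈ dependsOnlyOnX 𝕜 := ⟨fun x => ((f x : ℝ) : 𝕜), hm.coeFn_toLp⟩
  have h := (Submodule.mem_orthogonal _ _).1 hu _ hv
  rw [L2.inner_def] at h
  rw [← h]
  refine integral_congr_ae ?_
  filter_upwards [hm.coeFn_toLp] with p hp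
  rw [hp, RCLike.inner_apply, RCLike.conj_ofReal, RCLike.real_smul_eq_coe_mul, mul_comm]

/-- A function in `L²(X)` that integrates to zero against the smooth compactly supported
functions of `x` lies in `L²₀(X)`. -/
theorem mem_L20_of_test {w : L2X 𝕜}
    (H : ∀ f : ℝ → ℝ, ContDiff ℝ ∞ f → HasCompactSupport f →
      ∫ p : Cylinder, f p.1 • w p = 0) : w ∈ L20 𝕜 := by
  set G : ℝ → 𝕜 := fun x => ∫ θ : AddCircle (2 * Real.pi), w (x, θ) with hG
  have hloc : LocallyIntegrable G (volume : Measure ℝ) := by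
    rw [locallyIntegrable_iff]
    intro K hK
    have h1 : IntegrableOn w (K ×ˢ (Set.univ : Set (AddCircle (2 * Real.pi))))
        (volume : Measure Cylinder) :=
      (L2X_locallyIntegrable w).integrableOn_isCompact (hK.prod isCompact_univ)
    have h2 : (volume : Measure Cylinder).restrict (K ×ˢ Set.univ)
        = (volume.restrict K).prod volume := by
      rw [Measure.volume_eq_prod, ← Measure.prod_restrict, Measure.restrict_univ]
    rw [IntegrableOn, h2] at h1
    exact h1.integral_prod_left
  have hG0 : ∀ᵐ x, G x = 0 := by
    refine ae_eq_zero_of_integral_contDiff_smul_eq_zero hloc fun f hf hc => ?_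
    have h1 := H f hf hc
    have hi := integrable_smul w (f := fun p : Cylinder => f p.1)
      (hf.continuous.comp continuous_fst) (hasCompactSupport_comp_fst hc)
    refine Eq.trans ?_ ((integral_prod (μ := volume) (ν := volume) _ hi).symm.trans h1)
    refine integral_congr_ae (Filter.Eventually.of_forall fun x => ?_)
    exact (integral_smul (f x) _).symm
  refine (Submodule.mem_orthogonal _ _).2 ?_
  rintro v ⟨f, hf⟩
  rw [L2.inner_def]
  have hi : Integrable (fun p : Cylinder => inner 𝕜 (v p) (w p)) volume :=
    L2.integrable_inner v w
  have hcongr : (fun p : Cylinder => inner 𝕜 (v p) (w p)) =ᵐ[volume]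
      fun p => inner 𝕜 (f p.1) (w p) := by
    filter_upwards [hf] with p hp
    rw [hp]
  have hi2 := hi.congr hcongr
  rw [integral_congr_ae hcongr]
  refine (integral_prod (μ := volume) (ν := volume) _ hi2).trans ?_
  refine integral_eq_zero_of_ae ?_
  filter_upwards [hG0] with x hx
  simp only [RCLike.inner_apply, Pi.zero_apply]
  rw [integral_mul_const]
  have : ∫ θ : AddCircle (2 * Real.pi), w (x, θ) = 0 := hx
  rw [this, zero_mul]

theorem isWeakDxx_zero : IsWeakDxx (0 : L2X 𝕜) 0 := fun φ _ => by
  have h : ∀ f : Cylinder → ℝ, ∫ p, f p • (0 : L2X 𝕜) p = 0 := fun f => by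
    refine integral_eq_zero_of_ae ?_
    filter_upwards [Lp.coeFn_zero 𝕜 2 (volume : Measure Cylinder)] with p hp
    simp only [hp, Pi.zero_apply, smul_zero]
  rw [h, h]

theorem isWeakVDyy_zero (V : C(ℝ, ℝ)) : IsWeakVDyy V (0 : L2X 𝕜) 0 := fun φ _ => by
  have h : ∀ f : Cylinder → ℝ, ∫ p, f p • (0 : L2X 𝕜) p = 0 := fun f => by
    refine integral_eq_zero_of_ae ?_
    filter_upwards [Lp.coeFn_zero 𝕜 2 (volume : Measure Cylinder)] with p hp
    simp only [hp, Pi.zero_apply, smul_zero]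
  rw [h, h]

theorem integral_smul_add (u v : L2X 𝕜) {f : Cylinder → ℝ} (hf : Continuous f)
    (hc : HasCompactSupport f) :
    ∫ p, f p • (u + v) p = (∫ p, f p • u p) + ∫ p, f p • v p := by
  rw [← integral_add (integrable_smul u hf hc) (integrable_smul v hf hc)]
  refine integral_congr_ae ?_
  filter_upwards [Lp.coeFn_add u v] with p hp
  rw [hp, Pi.add_apply, smul_add]

theorem integral_smul_smul (c : 𝕜) (u : L2X 𝕜) (f : Cylinder → ℝ) :
    ∫ p, f p • (c • u) p = c • ∫ p, f p • u p := by
  rw [← integral_smul]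
  refine integral_congr_ae ?_
  filter_upwards [Lp.coeFn_smul c u] with p hp
  rw [hp, Pi.smul_apply, smul_comm]

theorem IsTest.continuous_mul_dy_dy (V : C(ℝ, ℝ)) {φ : Cylinder → ℝ} (h : IsTest φ) :
    Continuous (fun p : Cylinder => V p.1 * Grushin.dy (Grushin.dy φ) p) :=
  (V.continuous.comp continuous_fst).mul h.dy.dy.continuous

theorem IsTest.compact_mul_dy_dy (V : C(ℝ, ℝ)) {φ : Cylinder → ℝ} (h : IsTest φ) :
    HasCompactSupport (fun p : Cylinder => V p.1 * Grushin.dy (Grushin.dy φ) p) :=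
  h.dy.dy.compact.mul_left

theorem IsWeakDxx.add {u v g h : L2X 𝕜} (h1 : IsWeakDxx u g) (h2 : IsWeakDxx v h) :
    IsWeakDxx (u + v) (g + h) := fun φ hφ => by
  rw [integral_smul_add u v hφ.dx.dx.continuous hφ.dx.dx.compact,
    integral_smul_add g h hφ.continuous hφ.compact, h1 φ hφ, h2 φ hφ]

theorem IsWeakDxx.smul {u g : L2X 𝕜} (c : 𝕜) (h1 : IsWeakDxx u g) :
    IsWeakDxx (c • u) (c • g) := fun φ hφ => by
  rw [integral_smul_smul, integral_smul_smul, h1 φ hφ]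

theorem IsWeakVDyy.add {V : C(ℝ, ℝ)} {u v g h : L2X 𝕜} (h1 : IsWeakVDyy V u g)
    (h2 : IsWeakVDyy V v h) : IsWeakVDyy V (u + v) (g + h) := fun φ hφ => by
  rw [integral_smul_add u v (hφ.continuous_mul_dy_dy V) (hφ.compact_mul_dy_dy V),
    integral_smul_add g h hφ.continuous hφ.compact, h1 φ hφ, h2 φ hφ]

theorem IsWeakVDyy.smul {V : C(ℝ, ℝ)} {u g : L2X 𝕜} (c : 𝕜) (h1 : IsWeakVDyy V u g) :
    IsWeakVDyy V (c • u) (c • g) := fun φ hφ => by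
  rw [integral_smul_smul, integral_smul_smul, h1 φ hφ]

theorem IsWeakDxx.unique {u g h : L2X 𝕜} (h1 : IsWeakDxx u g) (h2 : IsWeakDxx u h) : g = h :=
  eq_of_test fun φ hφ => (h1 φ hφ).symm.trans (h2 φ hφ)

theorem IsWeakVDyy.unique {V : C(ℝ, ℝ)} {u g h : L2X 𝕜} (h1 : IsWeakVDyy V u g)
    (h2 : IsWeakVDyy V u h) : g = h :=
  eq_of_test fun φ hφ => (h1 φ hφ).symm.trans (h2 φ hφ)

theorem isTest_comp_fst {f : ℝ → ℝ} (hf : ContDiff ℝ ∞ f) (hc : HasCompactSupport f) :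
    IsTest (fun p : Cylinder => f p.1) :=
  ⟨hf.comp contDiff_fst, hasCompactSupport_comp_fst hc⟩

theorem IsWeakDxx.mem_L20 {u g : L2X 𝕜} (hu : u ∈ L20 𝕜) (h : IsWeakDxx u g) : g ∈ L20 𝕜 := by
  refine mem_L20_of_test fun f hf hc => ?_
  rw [← h _ (isTest_comp_fst hf hc)]
  have h2 : ContDiff ℝ ∞ (deriv (deriv f)) := by
    have h1 : ContDiff ℝ ∞ (deriv f) := ((contDiff_infty_iff_deriv).1 hf).2
    exact ((contDiff_infty_iff_deriv).1 h1).2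
  exact integral_eq_zero_of_mem_L20 hu h2.continuous hc.deriv.deriv

theorem IsWeakVDyy.mem_L20 {V : C(ℝ, ℝ)} {u h : L2X 𝕜} (hh : IsWeakVDyy V u h) :
    h ∈ L20 𝕜 := by
  refine mem_L20_of_test fun f hf hc => ?_
  rw [← hh _ (isTest_comp_fst hf hc)]
  simp [dy]

variable (𝕜) in
/-- The domain `D = {u ∈ L²₀(X) : ∂ₓ² u ∈ L²(X), V(x) ∂_y² u ∈ L²(X)}`. -/
def domain (V : C(ℝ, ℝ)) : Submodule 𝕜 (L20 𝕜) where
  carrier := {u | (∃ g : L2X 𝕜, IsWeakDxx (u : L2X 𝕜) g) ∧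
    ∃ h : L2X 𝕜, IsWeakVDyy V (u : L2X 𝕜) h}
  zero_mem' := ⟨⟨0, isWeakDxx_zero⟩, ⟨0, isWeakVDyy_zero V⟩⟩
  add_mem' := by
    rintro u v ⟨⟨g, hg⟩, ⟨h, hh⟩⟩ ⟨⟨g', hg'⟩, ⟨h', hh'⟩⟩
    exact ⟨⟨_, hg.add hg'⟩, ⟨_, hh.add hh'⟩⟩
  smul_mem' := by
    rintro c u ⟨⟨g, hg⟩, ⟨h, hh⟩⟩
    exact ⟨⟨_, hg.smul c⟩, ⟨_, hh.smul c⟩⟩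

variable (𝕜) in
/-- The Baouendi-Grushin operator `P_V u = -∂ₓ² u - V(x) ∂_y² u` in `L²₀(X)`, with domain `D`. -/
def operator (V : C(ℝ, ℝ)) : L20 𝕜 →ₗ.[𝕜] L20 𝕜 where
  domain := domain 𝕜 V
  toFun :=
    { toFun := fun u => ⟨-u.2.1.choose - u.2.2.choose,
        (L20 𝕜).sub_mem ((L20 𝕜).neg_mem (u.2.1.choose_spec.mem_L20 u.1.2))
          u.2.2.choose_spec.mem_L20⟩
      map_add' := fun u v => by
        apply Subtype.ext
        have h1 := (u + v).2.1.choose_spec.unique (u.2.1.choose_spec.add v.2.1.choose_spec)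
        have h2 := (u + v).2.2.choose_spec.unique (u.2.2.choose_spec.add v.2.2.choose_spec)
        simp only [h1, h2, Submodule.coe_add]
        abel
      map_smul' := fun c u => by
        apply Subtype.ext
        have h1 := (c • u).2.1.choose_spec.unique (u.2.1.choose_spec.smul c)
        have h2 := (c • u).2.2.choose_spec.unique (u.2.2.choose_spec.smul c)
        simp only [h1, h2, Submodule.coe_smul, RingHom.id_apply, smul_sub, smul_neg] }

/-- `P_V u = -g - h` whenever `g = ∂ₓ² u` and `h = V(x) ∂_y² u` weakly. -/
theorem operator_apply {V : C(ℝ, ℝ)} (u : (operator 𝕜 V).domain) {g h : L2X 𝕜}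
    (hg : IsWeakDxx ((u : L20 𝕜) : L2X 𝕜) g) (hh : IsWeakVDyy V ((u : L20 𝕜) : L2X 𝕜) h) :
    ((operator 𝕜 V u : L20 𝕜) : L2X 𝕜) = -g - h := by
  rw [← u.2.1.choose_spec.unique hg, ← u.2.2.choose_spec.unique hh]
  rfl

/-- The potential `x² + s²`. -/
def potential (s : ℝ) : C(ℝ, ℝ) := ⟨fun x => x ^ 2 + s ^ 2, by fun_prop⟩

variable (𝕜) in
/-- `P_s = P_{x² + s²}`. -/
def P (s : ℝ) : L20 𝕜 →ₗ.[𝕜] L20 𝕜 := operator 𝕜 (potential s)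

/-- `ker (T - E)` for an unbounded operator `T` on `H`. -/
def eigenspace {H : Type*} [AddCommGroup H] [Module 𝕜 H] (T : H →ₗ.[𝕜] H) (E : 𝕜) :
    Submodule 𝕜 H where
  carrier := {u | ∃ hu : u ∈ T.domain, T ⟨u, hu⟩ = E • u}
  zero_mem' := ⟨T.domain.zero_mem, by rw [smul_zero]; exact T.map_zero⟩
  add_mem' := by
    rintro u v ⟨hu, h1⟩ ⟨hv, h2⟩
    refine ⟨T.domain.add_mem hu hv, ?_⟩
    rw [smul_add, ← h1, ← h2]
    exact T.map_add ⟨u, hu⟩ ⟨v, hv⟩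
  smul_mem' := by
    rintro c u ⟨hu, h1⟩
    refine ⟨T.domain.smul_mem c hu, ?_⟩
    rw [smul_comm, ← h1]
    exact T.map_smul c ⟨u, hu⟩

/-- `E` is an eigenvalue of `T`. -/
def IsEigenvalue {H : Type*} [AddCommGroup H] [Module 𝕜 H] (T : H →ₗ.[𝕜] H) (E : 𝕜) : Prop :=
  ∃ u ∈ eigenspace T E, u ≠ 0

end

/-- The horizontal strip `w = ℝ × ]a, b[` in the cylinder. -/
def strip (a b : ℝ) : Set Cylinder := cover '' {q : ℝ × ℝ | q.2 ∈ Set.Ioo a b}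

end Grushin

end

noncomputable section

namespace Grushin

/-! ### Polynomials times a Gaussian -/

/-! Separate variables. On the Fourier modes cos(ny) and sin(ny), n ≥ 1, the operator acts as the
harmonic oscillator -d²/dx² + n²(x² + s²), whose eigenvalues are n²s² + n(2k + 1) with
eigenfunctions Hermite polynomial times exp(-nx²/2). The frequency n = 0 is absent from L²₀. When s²
is irrational the pair (n, k) can be recovered from the eigenvalue (`level_injective`), so each
eigenspace consists of the functions f(x)(α cos(ny) + β sin(ny)) with one fixed f and one fixed n.

The spectrum is found without an orthonormal Hermite basis. Testing the weak equation against x^k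
exp(-nx²/2) times a wave (`pairing_weak`, by cutoff) gives (E - level) m_k = -k(k-1) m_{k-2} for the
moments m_k of an eigenfunction (`pairing_recursion`). Hence a moment can start to be nonzero only
at a resonant pair, where E equals the level. Moments determine an L² function
(`eq_zero_of_pairing`, via analyticity of the Fourier transform and completeness of the
trigonometric system), so E must be a level, and with a unique resonant pair the eigenspace embeds
in 𝕜² (`finrank_eigenspace_le`). Two explicit product functions give the reverse bound
(`mode_mem_eigenspace`, `exists_modes`).

For concentration, the factor in x cancels between cylinder and strip. What remains is an estimate
on the circle for |α cos(ny) + β sin(ny)|² over an arc, uniform in n (`integral_trig_ge`). The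
uniformity comes from |sin(nt)| ≤ n|sin t| together with |sin t| < t for t > 0. -/

open Polynomial in
/-- The function `p(x) exp(-c x² / 2)`. -/
def polyGauss (c : ℝ) (p : ℝ[X]) (x : ℝ) : ℝ := p.eval x * Real.exp (-(c / 2) * x ^ 2)

open Polynomial in
/-- The derivative of `polyGauss`, on polynomials. -/
def gaussDeriv (c : ℝ) (p : ℝ[X]) : ℝ[X] := derivative p - C c * X * p

section
open Polynomial

theorem hasDerivAt_polyGauss (c : ℝ) (p : ℝ[X]) (x : ℝ) :
    HasDerivAt (polyGauss c p) (polyGauss c (gaussDeriv c p) x) x := by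
  have h1 : HasDerivAt (fun x : ℝ => -(c / 2) * x ^ 2) (-(c * x)) x := by
    have h := (hasDerivAt_pow 2 x).const_mul (-(c / 2))
    refine h.congr_deriv ?_
    norm_num
    ring
  refine ((p.hasDerivAt x).mul h1.exp).congr_deriv ?_
  simp only [polyGauss, gaussDeriv, eval_sub, eval_mul, eval_C, eval_X]
  ring

theorem deriv_polyGauss (c : ℝ) (p : ℝ[X]) :
    deriv (polyGauss c p) = polyGauss c (gaussDeriv c p) :=
  funext fun x => (hasDerivAt_polyGauss c p x).deriv

theorem contDiff_polyGauss (c : ℝ) (p : ℝ[X]) : ContDiff ℝ ∞ (polyGauss c p) := by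
  unfold polyGauss
  have h : ContDiff ℝ ∞ fun x : ℝ => p.eval x := by
    simpa using contDiff_aeval (𝕜 := ℝ) p ∞
  fun_prop

theorem continuous_polyGauss (c : ℝ) (p : ℝ[X]) : Continuous (polyGauss c p) :=
  (contDiff_polyGauss c p).continuous

/-- This polynomial identity serves both the Hermite equation and the moment recursion. -/
theorem gaussDeriv_gaussDeriv (c : ℝ) (p : ℝ[X]) :
    gaussDeriv c (gaussDeriv c p) =
      derivative (derivative p) - C c * p - C (2 * c) * X * derivative p
        + C (c ^ 2) * X ^ 2 * p := by
  simp only [gaussDeriv, derivative_sub, derivative_mul, derivative_C, derivative_X, C_mul, C_pow]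
  have : (C 2 : ℝ[X]) = 2 := rfl
  rw [this]
  ring

/-- A polynomial grows slower than any exponential. -/
theorem exists_abs_eval_le (p : ℝ[X]) :
    ∃ C : ℝ, 0 ≤ C ∧ ∀ x : ℝ, |p.eval x| ≤ C * Real.exp |x| := by
  induction p using Polynomial.induction_on' with
  | add p q hp hq =>
    obtain ⟨A, hA, h1⟩ := hp
    obtain ⟨B, hB, h2⟩ := hq
    refine ⟨A + B, by positivity, fun x => ?_⟩
    rw [eval_add, add_mul]
    exact (abs_add_le _ _).trans (add_le_add (h1 x) (h2 x))
  | monomial k a =>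
    refine ⟨|a| * k.factorial, by positivity, fun x => ?_⟩
    rw [eval_monomial, abs_mul, abs_pow, mul_assoc]
    gcongr
    have := Real.pow_div_factorial_le_exp |x| (abs_nonneg x) k
    rwa [div_le_iff₀' (by positivity)] at this

/-- Half of the Gaussian exponent absorbs the linear exponent (1 + t)|x|, where the 1 accounts for
the polynomial. The weight exp(t|x|) is what the determinacy of moments will require. -/
theorem exists_abs_polyGauss_mul_exp_le {c : ℝ} (hc : 0 < c) (p : ℝ[X]) (t : ℝ) :
    ∃ C : ℝ, 0 ≤ C ∧ ∀ x : ℝ,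
      |polyGauss c p x * Real.exp (t * |x|)| ≤ C * Real.exp (-(c / 4) * x ^ 2) := by
  obtain ⟨A, hA, h⟩ := exists_abs_eval_le p
  refine ⟨A * Real.exp ((1 + t) ^ 2 / c), by positivity, fun x => ?_⟩
  rw [polyGauss, abs_mul, abs_mul, Real.abs_exp, Real.abs_exp]
  calc _ ≤ A * Real.exp |x| * Real.exp (-(c / 2) * x ^ 2) * Real.exp (t * |x|) := by
        gcongr
        exact h x
    _ = A * Real.exp (|x| + -(c / 2) * x ^ 2 + t * |x|) := by rw [Real.exp_add, Real.exp_add]; ring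
    _ ≤ A * Real.exp ((1 + t) ^ 2 / c + -(c / 4) * x ^ 2) := by
        refine mul_le_mul_of_nonneg_left (Real.exp_le_exp.2 ?_) hA
        rw [← sq_abs x]
        -- Completing the square; this is where the constant (1 + t)²/c comes from.
        have : (1 + t) ^ 2 / c + -(c / 4) * |x| ^ 2 - (|x| + -(c / 2) * |x| ^ 2 + t * |x|)
            = ((1 + t) - c / 2 * |x|) ^ 2 / c := by
          field_simp
          ring
        have h2 : 0 ≤ ((1 + t) - c / 2 * |x|) ^ 2 / c := by positivity
        linarith
    _ = _ := by rw [Real.exp_add]; ring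

theorem memLp_polyGauss_mul_exp {c : ℝ} (hc : 0 < c) (p : ℝ[X]) (t : ℝ) :
    MemLp (fun x => polyGauss c p x * Real.exp (t * |x|)) 2 := by
  obtain ⟨C, hC, h⟩ := exists_abs_polyGauss_mul_exp_le hc p t
  have hm : MemLp (fun x : ℝ => C * Real.exp (-(c / 4) * x ^ 2)) 2 := by
    rw [memLp_two_iff_integrable_sq (by fun_prop)]
    convert (integrable_exp_neg_mul_sq (b := c / 2) (by positivity)).const_mul (C ^ 2) using 2 with x
    rw [mul_pow, ← Real.exp_nat_mul]
    congr 2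
    push_cast
    ring
  refine hm.mono' ?_ (Filter.Eventually.of_forall h)
  have := continuous_polyGauss c p
  fun_prop

theorem memLp_polyGauss {c : ℝ} (hc : 0 < c) (p : ℝ[X]) : MemLp (polyGauss c p) 2 := by
  simpa using memLp_polyGauss_mul_exp hc p 0

end

/-! ### Determinacy of moments -/

/-- A function with exponential decay all of whose moments vanish is zero. -/
theorem ae_eq_zero_of_moments {F : ℝ → ℝ}
    (hF : ∀ t : ℝ, Integrable (fun x => Real.exp (t * |x|) * F x))
    (h0 : ∀ k : ℕ, ∫ x, x ^ k * F x = 0) : F =ᵐ[volume] 0 := by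
  have hi : Integrable F := by simpa using hF 0
  have hchar : ∀ ξ : ℝ, ∫ x : ℝ, Complex.exp (ξ * x * Complex.I) * (F x : ℂ) = 0 := by
    intro ξ
    -- The Fourier transform is expanded in powers of ξ and integrated termwise, each term being a
    -- multiple of a moment. The series is dominated by exp(|ξ||x|)|F(x)|, integrable by `hF`.
    have key := hasSum_integral_of_dominated_convergence (μ := (volume : Measure ℝ))
      (F := fun (k : ℕ) (x : ℝ) => (ξ * x * Complex.I) ^ k / (k.factorial : ℂ) * (F x : ℂ))
      (f := fun x : ℝ => Complex.exp (ξ * x * Complex.I) * (F x : ℂ))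
      (fun k x => (|ξ| * |x|) ^ k / k.factorial * |F x|) ?_ ?_ ?_ ?_ ?_
    · refine key.unique ?_
      convert hasSum_zero with k
      have h1 : (fun x : ℝ => (ξ * x * Complex.I) ^ k / (k.factorial : ℂ) * (F x : ℂ))
          = fun x : ℝ => ((ξ * Complex.I) ^ k / (k.factorial : ℂ)) * ((x ^ k * F x : ℝ) : ℂ) := by
        funext x
        push_cast
        ring
      rw [h1, integral_const_mul, integral_complex_ofReal, h0]
      simp
    · intro k
      have := Complex.continuous_ofReal.comp_aestronglyMeasurable hi.aestronglyMeasurable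
      refine AEStronglyMeasurable.mul ?_ this
      exact Continuous.aestronglyMeasurable (by fun_prop)
    · intro k
      refine Filter.Eventually.of_forall fun x => ?_
      simp [mul_pow]
    · refine Filter.Eventually.of_forall fun x => ?_
      exact (Real.summable_pow_div_factorial _).mul_right _
    · have h1 := (hF |ξ|).abs
      refine h1.congr (Filter.Eventually.of_forall fun x => ?_)
      simp only
      rw [tsum_mul_right, abs_mul, Real.abs_exp, Real.exp_eq_exp_ℝ, NormedSpace.exp_eq_tsum_div]
    · refine Filter.Eventually.of_forall fun x => ?_
      refine HasSum.mul_right _ ?_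
      rw [Complex.exp_eq_exp_ℂ]
      exact NormedSpace.expSeries_div_hasSum_exp _
  -- The positive and negative parts of F are viewed as densities of finite measures. Vanishing of
  -- the transform says that their characteristic functions agree, so the measures agree and F
  -- vanishes almost everywhere.
  have hfin1 : IsFiniteMeasure (volume.withDensity fun x => ENNReal.ofReal (F x)) :=
    isFiniteMeasure_withDensity_ofReal hi.2
  have hfin2 : IsFiniteMeasure (volume.withDensity fun x => ENNReal.ofReal (-F x)) :=
    isFiniteMeasure_withDensity_ofReal hi.neg.2
  have hm1 : AEMeasurable (fun x => ENNReal.ofReal (F x)) := hi.aemeasurable.ennreal_ofReal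
  have hm2 : AEMeasurable (fun x => ENNReal.ofReal (-F x)) := hi.neg.aemeasurable.ennreal_ofReal
  have hexp : ∀ (ξ : ℝ) {G : ℝ → ℝ}, Integrable (fun x => max (G x) 0) →
      Integrable fun x : ℝ => (ENNReal.ofReal (G x)).toReal • Complex.exp (ξ * x * Complex.I) := by
    intro ξ G hG
    refine hG.mono' ?_ (Filter.Eventually.of_forall fun x => ?_)
    · simp only [ENNReal.toReal_ofReal']
      exact hG.aestronglyMeasurable.smul (Continuous.aestronglyMeasurable (by fun_prop))
    · rw [norm_smul, ← Complex.ofReal_mul, Complex.norm_exp_ofReal_mul_I, ENNReal.toReal_ofReal', mul_one,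
        Real.norm_of_nonneg (le_max_right _ _)]
  have heq : (volume.withDensity fun x => ENNReal.ofReal (F x))
      = volume.withDensity fun x => ENNReal.ofReal (-F x) := by
    refine Measure.ext_of_charFun (funext fun ξ => ?_)
    rw [charFun_apply_real, charFun_apply_real,
      integral_withDensity_eq_integral_toReal_smul₀ hm1 (by simp),
      integral_withDensity_eq_integral_toReal_smul₀ hm2 (by simp), ← sub_eq_zero,
      ← integral_sub]
    · rw [← hchar ξ]
      refine integral_congr_ae (Filter.Eventually.of_forall fun x => ?_)
      simp only [ENNReal.toReal_ofReal', Complex.real_smul]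
      rw [← sub_mul, mul_comm, ← Complex.ofReal_sub, max_zero_sub_max_neg_zero_eq_self]
    · exact hexp ξ hi.pos_part
    · exact hexp ξ hi.neg_part
  rw [withDensity_eq_iff_of_sigmaFinite hm1 hm2] at heq
  filter_upwards [heq] with x hx
  have := congrArg ENNReal.toReal hx
  simp only [ENNReal.toReal_ofReal'] at this
  rw [Pi.zero_apply, ← max_zero_sub_max_neg_zero_eq_self (F x), this, sub_self]

/-! ### Trigonometric functions on the circle -/

/-- The function `y ↦ cos (n y + θ)` on the circle. -/
def wave (n : ℕ) (θ : ℝ) : C(AddCircle (2 * Real.pi), ℝ) :=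
  ⟨fun y => (Complex.exp (θ * Complex.I) * fourier n y).re, by fun_prop⟩

theorem wave_coe (n : ℕ) (θ y : ℝ) :
    wave n θ (y : AddCircle (2 * Real.pi)) = Real.cos (n * y + θ) := by
  have h : (2 * Real.pi * Complex.I * ((n : ℤ) : ℂ) * y / ((2 * Real.pi : ℝ) : ℂ) : ℂ)
      = ((n * y : ℝ) : ℂ) * Complex.I := by
    have := Complex.ofReal_ne_zero.2 Real.pi_ne_zero
    push_cast
    field_simp
  change (Complex.exp (θ * Complex.I) * fourier n (y : AddCircle (2 * Real.pi))).re = _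
  rw [fourier_coe_apply, h, ← Complex.exp_add, ← add_mul, ← Complex.ofReal_add,
    Complex.exp_ofReal_mul_I_re, add_comm]

theorem fourier_eq_wave (n : ℕ) (y : AddCircle (2 * Real.pi)) :
    fourier n y = (wave n 0 y : ℂ) + (wave n (-(Real.pi / 2)) y : ℂ) * Complex.I := by
  have h1 : wave n 0 y = (fourier n y).re := by
    change (Complex.exp ((0 : ℝ) * Complex.I) * fourier n y).re = _
    rw [Complex.ofReal_zero, zero_mul, Complex.exp_zero, one_mul]
  have h2 : wave n (-(Real.pi / 2)) y = (fourier n y).im := by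
    change (Complex.exp ((-(Real.pi / 2) : ℝ) * Complex.I) * fourier n y).re = _
    rw [Complex.exp_mul_I, ← Complex.ofReal_cos, ← Complex.ofReal_sin, Real.cos_neg, Real.sin_neg,
      Real.cos_pi_div_two, Real.sin_pi_div_two]
    simp only [Complex.mul_re, Complex.add_re, Complex.ofReal_re, Complex.ofReal_im,
      Complex.I_re, Complex.I_im, Complex.add_im, Complex.mul_im]
    ring
  rw [h1, h2, Complex.re_add_im]

/-- The trigonometric functions are complete in `L²` of the circle. -/
theorem ae_eq_zero_of_integral_wave {f : AddCircle (2 * Real.pi) → ℝ} (hf : MemLp f 2)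
    (h : ∀ n : ℕ, ∫ y, wave n 0 y * f y = 0 ∧ ∫ y, wave n (-(Real.pi / 2)) y * f y = 0) :
    f =ᵐ[volume] 0 := by
  have hi : ∀ T : C(AddCircle (2 * Real.pi), ℝ), Integrable fun y => T y * f y := fun T =>
    MemLp.integrable_mul (p := 2) (q := 2)
      (T.continuous.memLp_of_hasCompactSupport (HasCompactSupport.of_compactSpace _)) hf
  have hpos : ∀ n : ℕ, ∫ y, fourier n y * (f y : ℂ) = 0 := by
    intro n
    have h1 : (fun y => fourier n y * (f y : ℂ)) = fun y =>
        ((wave n 0 y * f y : ℝ) : ℂ) + ((wave n (-(Real.pi / 2)) y * f y : ℝ) : ℂ) * Complex.I := by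
      funext y
      rw [fourier_eq_wave]
      push_cast
      ring
    rw [h1, integral_add (hi _).ofReal ((hi _).ofReal.mul_const _), integral_mul_const,
      integral_complex_ofReal, integral_complex_ofReal, (h n).1, (h n).2]
    simp
  -- As f is real, negative frequencies follow by conjugation.
  have hneg : ∀ n : ℕ, ∫ y, fourier (-(n : ℤ)) y * (f y : ℂ) = 0 := by
    intro n
    have h1 : (fun y => fourier (-(n : ℤ)) y * (f y : ℂ))
        = fun y => (starRingEnd ℂ) (fourier n y * (f y : ℂ)) := by
      funext y
      rw [map_mul, Complex.conj_ofReal, fourier_neg]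
    rw [h1, integral_conj, hpos, map_zero]
  have hall : ∀ n : ℤ, ∫ y, fourier n y * (f y : ℂ) = 0 := by
    intro n
    obtain ⟨m, rfl | rfl⟩ := n.eq_nat_or_neg
    · exact hpos m
    · exact hneg m
  have hm : MemLp (fun y => (f y : ℂ)) 2 AddCircle.haarAddCircle :=
    memLp_haarAddCircle_iff.2 hf.ofReal
  have h0 : hm.toLp = 0 := by
    apply (fourierBasis (T := 2 * Real.pi)).repr.injective
    rw [map_zero]
    ext i
    rw [fourierBasis_repr, fourierCoeff_congr_ae hm.coeFn_toLp, fourierCoeff,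
      AddCircle.integral_haarAddCircle]
    simp only [smul_eq_mul]
    rw [hall, smul_zero]
    rfl
  have h1 := hm.coeFn_toLp
  rw [h0] at h1
  have h2 : ∀ᵐ y ∂(AddCircle.haarAddCircle (T := 2 * Real.pi)), f y = 0 := by
    filter_upwards [h1, Lp.coeFn_zero ℂ 2 AddCircle.haarAddCircle] with y hy hz
    rw [hz] at hy
    exact Complex.ofReal_eq_zero.1 hy.symm
  rw [AddCircle.volume_eq_smul_haarAddCircle]
  exact Measure.ae_smul_measure h2 _

/-! ### Completeness on the cylinder -/

/-- The product function `f(x) T(y)` on the cylinder. -/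
def tensor (f : ℝ → ℝ) (T : C(AddCircle (2 * Real.pi), ℝ)) (p : Cylinder) : ℝ := f p.1 * T p.2

theorem memLp_tensor {f : ℝ → ℝ} (hf : MemLp f 2) (T : C(AddCircle (2 * Real.pi), ℝ)) :
    MemLp (tensor f T) 2 := by
  have hT : MemLp T 2 volume :=
    T.continuous.memLp_of_hasCompactSupport (HasCompactSupport.of_compactSpace _)
  have hm : AEStronglyMeasurable (tensor f T) volume :=
    hf.1.comp_fst.mul hT.1.comp_snd
  rw [memLp_two_iff_integrable_sq hm]
  have := ((memLp_two_iff_integrable_sq hf.1).1 hf).mul_prod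
    ((memLp_two_iff_integrable_sq hT.1).1 hT)
  refine this.congr (Filter.Eventually.of_forall fun p => ?_)
  simp only [tensor, mul_pow]

-- By Fubini, the hypothesis says that all moments vanish for the Gaussian times the function x ↦ ∫
-- T(y) w(x, y) dy; the Gaussian supplies the exponential decay needed for `ae_eq_zero_of_moments`.
open Polynomial in
theorem ae_integral_eq_zero_of_moments {w : Cylinder → ℝ} (hw : MemLp w 2) {c : ℝ} (hc : 0 < c)
    (T : C(AddCircle (2 * Real.pi), ℝ))
    (h : ∀ k : ℕ, ∫ p, tensor (polyGauss c (X ^ k)) T p * w p = 0) :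
    ∀ᵐ x : ℝ, ∫ y, T y * w (x, y) = 0 := by
  have hi : ∀ (q : ℝ[X]) (t : ℝ), Integrable
      (fun p => tensor (fun x => polyGauss c q x * Real.exp (t * |x|)) T p * w p) := fun q t =>
    MemLp.integrable_mul (p := 2) (q := 2) (memLp_tensor (memLp_polyGauss_mul_exp hc q t) T) hw
  have key := ae_eq_zero_of_moments
    (F := fun x => Real.exp (-(c / 2) * x ^ 2) * ∫ y, T y * w (x, y)) ?_ ?_
  · filter_upwards [key] with x hx
    exact (mul_eq_zero.1 hx).resolve_left (Real.exp_ne_zero _)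
  · intro t
    have h1 := (hi 1 t).integral_prod_left
    refine h1.congr (Filter.Eventually.of_forall fun x => ?_)
    simp only [tensor, polyGauss, eval_one, one_mul]
    rw [← integral_const_mul, ← integral_const_mul]
    refine integral_congr_ae (Filter.Eventually.of_forall fun y => ?_)
    ring
  · intro k
    have h1 := hi (X ^ k) 0
    simp only [zero_mul, Real.exp_zero, mul_one] at h1
    have h2 := (integral_prod (μ := volume) (ν := volume) _ h1).symm.trans (h k)
    rw [← h2]
    refine integral_congr_ae (Filter.Eventually.of_forall fun x => ?_)
    simp only [tensor, polyGauss, eval_pow, eval_X]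
    rw [← integral_const_mul, ← integral_const_mul]
    refine integral_congr_ae (Filter.Eventually.of_forall fun y => ?_)
    ring

open Polynomial in
/-- The Hermite-Fourier functions are complete in `L²` of the cylinder. -/
theorem ae_eq_zero_of_moments_wave {w : Cylinder → ℝ} (hw : MemLp w 2)
    (h : ∀ n : ℕ, ∃ c : ℝ, 0 < c ∧ ∀ k : ℕ,
      ∫ p, tensor (polyGauss c (X ^ k)) (wave n 0) p * w p = 0 ∧
      ∫ p, tensor (polyGauss c (X ^ k)) (wave n (-(Real.pi / 2))) p * w p = 0) :
    w =ᵐ[volume] 0 := by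
  have h1 : ∀ᵐ x : ℝ, ∀ n : ℕ,
      ∫ y, wave n 0 y * w (x, y) = 0 ∧ ∫ y, wave n (-(Real.pi / 2)) y * w (x, y) = 0 := by
    refine ae_all_iff.2 fun n => ?_
    obtain ⟨c, hc, hk⟩ := h n
    exact (ae_integral_eq_zero_of_moments hw hc _ fun k => (hk k).1).and
      (ae_integral_eq_zero_of_moments hw hc _ fun k => (hk k).2)
  have h2 : ∀ᵐ x : ℝ, Integrable (fun y => w (x, y) ^ 2) :=
    ((memLp_two_iff_integrable_sq hw.1).1 hw).prod_right_ae
  have h3 : ∀ᵐ x : ℝ, AEStronglyMeasurable (fun y => w (x, y)) volume := hw.1.prodMk_left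
  have h4 : ∀ᵐ x : ℝ, ∀ᵐ y, w (x, y) = 0 := by
    filter_upwards [h1, h2, h3] with x hx1 hx2 hx3
    exact ae_eq_zero_of_integral_wave ((memLp_two_iff_integrable_sq hx3).2 hx2) hx1
  have h5 : ∫ p, w p ^ 2 = 0 := by
    refine (integral_prod (μ := volume) (ν := volume) _
      ((memLp_two_iff_integrable_sq hw.1).1 hw)).trans ?_
    refine integral_eq_zero_of_ae ?_
    filter_upwards [h4] with x hx
    refine integral_eq_zero_of_ae ?_
    filter_upwards [hx] with y hy
    simp [hy]
  have h6 := (integral_eq_zero_iff_of_nonneg (fun p => sq_nonneg (w p))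
    ((memLp_two_iff_integrable_sq hw.1).1 hw)).1 h5
  filter_upwards [h6] with p hp
  exact pow_eq_zero_iff (two_ne_zero) |>.1 hp

section
variable {𝕜 : Type*} [RCLike 𝕜]

/-! ### Pairing with product functions -/

/-- The integral of `u` against `f(x) T(y)`. -/
def pairing (u : L2X 𝕜) (f : ℝ → ℝ) (T : C(AddCircle (2 * Real.pi), ℝ)) : 𝕜 :=
  ∫ p, tensor f T p • u p

theorem integrable_tensor_smul (u : L2X 𝕜) {f : ℝ → ℝ} (hf : MemLp f 2)
    (T : C(AddCircle (2 * Real.pi), ℝ)) : Integrable (fun p => tensor f T p • u p) :=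
  memLp_one_iff_integrable.1 (MemLp.smul (p := 2) (q := 2) (Lp.memLp u) (memLp_tensor hf T))

theorem pairing_add (u : L2X 𝕜) {f g : ℝ → ℝ} (hf : MemLp f 2) (hg : MemLp g 2)
    (T : C(AddCircle (2 * Real.pi), ℝ)) :
    pairing u (fun x => f x + g x) T = pairing u f T + pairing u g T := by
  rw [pairing, pairing, pairing, ← integral_add (integrable_tensor_smul u hf T)
    (integrable_tensor_smul u hg T)]
  simp only [tensor, add_mul, add_smul]

theorem pairing_const_mul (u : L2X 𝕜) (c : ℝ) (f : ℝ → ℝ) (T : C(AddCircle (2 * Real.pi), ℝ)) :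
    pairing u (fun x => c * f x) T = c • pairing u f T := by
  rw [pairing, pairing, ← integral_smul]
  simp only [tensor, mul_assoc, smul_smul]

theorem pairing_add_left (u v : L2X 𝕜) {f : ℝ → ℝ} (hf : MemLp f 2)
    (T : C(AddCircle (2 * Real.pi), ℝ)) :
    pairing (u + v) f T = pairing u f T + pairing v f T := by
  rw [pairing, pairing, pairing, ← integral_add (integrable_tensor_smul u hf T)
    (integrable_tensor_smul v hf T)]
  refine integral_congr_ae ?_
  filter_upwards [Lp.coeFn_add u v] with p hp
  rw [hp, Pi.add_apply, smul_add]

theorem pairing_smul_left (r : 𝕜) (u : L2X 𝕜) (f : ℝ → ℝ) (T : C(AddCircle (2 * Real.pi), ℝ)) :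
    pairing (r • u) f T = r * pairing u f T :=
  integral_smul_smul r u (tensor f T)

open Polynomial in
/-- An element of `L²` is determined by its Hermite-Fourier moments. -/
theorem eq_zero_of_pairing {u : L2X 𝕜}
    (h : ∀ n : ℕ, ∃ c : ℝ, 0 < c ∧ ∀ k : ℕ,
      pairing u (polyGauss c (X ^ k)) (wave n 0) = 0 ∧
      pairing u (polyGauss c (X ^ k)) (wave n (-(Real.pi / 2))) = 0) : u = 0 := by
  have hre : (fun p => RCLike.re (u p)) =ᵐ[volume] 0 := by
    refine ae_eq_zero_of_moments_wave (Lp.memLp u).re fun n => ?_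
    obtain ⟨c, hc, hk⟩ := h n
    have key : ∀ (k : ℕ) (T : C(AddCircle (2 * Real.pi), ℝ)),
        pairing u (polyGauss c (X ^ k)) T = 0 →
        ∫ p, tensor (polyGauss c (X ^ k)) T p * RCLike.re (u p) = 0 := by
      intro k T hT
      have h1 := integral_re (integrable_tensor_smul u (memLp_polyGauss hc (X ^ k)) T)
      change _ = RCLike.re (pairing u _ T) at h1
      rw [hT, map_zero] at h1
      rw [← h1]
      simp only [RCLike.smul_re]
    exact ⟨c, hc, fun k => ⟨key k _ (hk k).1, key k _ (hk k).2⟩⟩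
  have him : (fun p => RCLike.im (u p)) =ᵐ[volume] 0 := by
    refine ae_eq_zero_of_moments_wave (Lp.memLp u).im fun n => ?_
    obtain ⟨c, hc, hk⟩ := h n
    have key : ∀ (k : ℕ) (T : C(AddCircle (2 * Real.pi), ℝ)),
        pairing u (polyGauss c (X ^ k)) T = 0 →
        ∫ p, tensor (polyGauss c (X ^ k)) T p * RCLike.im (u p) = 0 := by
      intro k T hT
      have h1 := integral_im (integrable_tensor_smul u (memLp_polyGauss hc (X ^ k)) T)
      change _ = RCLike.im (pairing u _ T) at h1
      rw [hT, map_zero] at h1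
      rw [← h1]
      simp only [RCLike.smul_im]
    exact ⟨c, hc, fun k => ⟨key k _ (hk k).1, key k _ (hk k).2⟩⟩
  apply Lp.ext
  filter_upwards [hre, him, Lp.coeFn_zero 𝕜 2 (volume : Measure Cylinder)] with p h1 h2 h3
  rw [h3]
  refine RCLike.ext ?_ ?_
  · simpa using h1
  · simpa using h2

/-- At frequency zero the wave is constant, so the test function depends on x alone and is
orthogonal to L²₀. This disposes of the one frequency for which there is no oscillator. -/
theorem pairing_wave_zero {u : L2X 𝕜} (hu : u ∈ L20 𝕜) {f : ℝ → ℝ} (hf : MemLp f 2) (θ : ℝ) :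
    pairing u f (wave 0 θ) = 0 := by
  have hw : ∀ y, wave 0 θ y = Real.cos θ := by
    intro y
    induction y using QuotientAddGroup.induction_on with
    | H y => exact (wave_coe 0 θ y).trans (by simp)
  have hm : MemLp (fun p : Cylinder => ((tensor f (wave 0 θ) p : ℝ) : 𝕜)) 2 volume :=
    (memLp_tensor hf _).ofReal
  have hv : hm.toLp ∈ dependsOnlyOnX 𝕜 := by
    refine ⟨fun x => ((f x * Real.cos θ : ℝ) : 𝕜), ?_⟩
    filter_upwards [hm.coeFn_toLp] with p hp
    rw [hp, tensor, hw]
  have h := (Submodule.mem_orthogonal _ _).1 hu _ hv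
  rw [L2.inner_def] at h
  rw [← h, pairing]
  refine integral_congr_ae ?_
  filter_upwards [hm.coeFn_toLp] with p hp
  rw [hp, RCLike.inner_apply, RCLike.conj_ofReal, RCLike.real_smul_eq_coe_mul, mul_comm]

/-! ### The weak eigenvalue equation tested against product functions -/

theorem contDiff_wave (n : ℕ) (θ : ℝ) :
    ContDiff ℝ ∞ fun y : ℝ => wave n θ (y : AddCircle (2 * Real.pi)) := by
  simp only [wave_coe]
  fun_prop

theorem hasDerivAt_wave (n : ℕ) (θ y : ℝ) :
    HasDerivAt (fun y : ℝ => wave n θ (y : AddCircle (2 * Real.pi)))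
      (n * wave n (θ + Real.pi / 2) (y : AddCircle (2 * Real.pi))) y := by
  simp only [wave_coe]
  have h1 : HasDerivAt (fun y : ℝ => n * y + θ) (n : ℝ) y := by
    simpa using ((hasDerivAt_id y).const_mul (n : ℝ)).add_const θ
  refine h1.cos.congr_deriv ?_
  rw [← add_assoc, Real.cos_add_pi_div_two]
  ring

/-- Each derivative in y shifts the phase by π/2, so two of them produce the sign in -n². -/
theorem wave_add_pi (n : ℕ) (θ : ℝ) (y : AddCircle (2 * Real.pi)) :
    wave n (θ + Real.pi / 2 + Real.pi / 2) y = -wave n θ y := by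
  induction y using QuotientAddGroup.induction_on with
  | H y =>
    refine (wave_coe n _ y).trans (Eq.trans ?_ (congrArg Neg.neg (wave_coe n θ y)).symm)
    rw [add_assoc θ, add_halves, ← add_assoc, Real.cos_add_pi]

theorem isTest_tensor_wave {f : ℝ → ℝ} (hf : ContDiff ℝ ∞ f) (hc : HasCompactSupport f)
    (n : ℕ) (θ : ℝ) : IsTest (tensor f (wave n θ)) := by
  constructor
  · exact (hf.comp contDiff_fst).mul ((contDiff_wave n θ).comp contDiff_snd)
  · exact (hasCompactSupport_comp_fst hc).mul_right

theorem dx_tensor (f : ℝ → ℝ) (T : C(AddCircle (2 * Real.pi), ℝ)) :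
    dx (tensor f T) = tensor (deriv f) T := by
  funext p
  exact deriv_mul_const_field (T p.2)

theorem dy_tensor_wave (f : ℝ → ℝ) (n : ℕ) (θ : ℝ) :
    dy (tensor f (wave n θ)) = tensor (fun x => n * f x) (wave n (θ + Real.pi / 2)) := by
  funext ⟨x, y⟩
  induction y using QuotientAddGroup.induction_on with
  | H y =>
    have h1 : HasDerivAt (fun t : ℝ => f x * wave n θ ((y + t : ℝ) : AddCircle (2 * Real.pi)))
        (f x * (n * wave n (θ + Real.pi / 2) ((y + 0 : ℝ) : AddCircle (2 * Real.pi)))) 0 :=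
      ((hasDerivAt_wave n θ (y + 0)).comp_const_add y 0).const_mul _
    refine h1.deriv.trans ?_
    rw [add_zero]
    simp only [tensor]
    change _ = n * f x * wave n (θ + Real.pi / 2) (y : AddCircle (2 * Real.pi))
    ring

theorem dy_dy_tensor_wave (f : ℝ → ℝ) (n : ℕ) (θ : ℝ) (p : Cylinder) :
    dy (dy (tensor f (wave n θ))) p = -(n : ℝ) ^ 2 * tensor f (wave n θ) p := by
  rw [dy_tensor_wave, dy_tensor_wave]
  simp only [tensor, wave_add_pi]
  ring

/-- The eigenvalue equation in weak form. -/
theorem eigenspace_weak {V : C(ℝ, ℝ)} {E : 𝕜} {u : L20 𝕜} (hu : u ∈ eigenspace (operator 𝕜 V) E)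
    {φ : Cylinder → ℝ} (hφ : IsTest φ) :
    (∫ p, dx (dx φ) p • (u : L2X 𝕜) p) + ∫ p, (V p.1 * dy (dy φ) p) • (u : L2X 𝕜) p
      = -(E * ∫ p, φ p • (u : L2X 𝕜) p) := by
  obtain ⟨hd, he⟩ := hu
  obtain ⟨⟨g, hg⟩, ⟨h, hh⟩⟩ := id hd
  have h1 := operator_apply (𝕜 := 𝕜) (V := V) ⟨u, hd⟩ hg hh
  rw [he] at h1
  have h2 : E • (u : L2X 𝕜) = -g - h := h1
  have h3 : g + h = (-E) • (u : L2X 𝕜) := by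
    rw [neg_smul, h2]
    abel
  rw [hg φ hφ, hh φ hφ, ← integral_smul_add g h hφ.continuous hφ.compact, h3, integral_smul_smul,
    smul_eq_mul, neg_mul]

theorem pairing_weak_of_hasCompactSupport {V : C(ℝ, ℝ)} {E : 𝕜} {u : L20 𝕜}
    (hu : u ∈ eigenspace (operator 𝕜 V) E) {f : ℝ → ℝ} (hf : ContDiff ℝ ∞ f)
    (hc : HasCompactSupport f) (n : ℕ) (θ : ℝ) :
    pairing (u : L2X 𝕜) (deriv (deriv f)) (wave n θ)
        + (-(n : ℝ) ^ 2) • pairing (u : L2X 𝕜) (fun x => V x * f x) (wave n θ)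
      = -(E * pairing (u : L2X 𝕜) f (wave n θ)) := by
  have h := eigenspace_weak hu (isTest_tensor_wave hf hc n θ)
  rw [dx_tensor, dx_tensor] at h
  rw [← pairing_const_mul]
  refine Eq.trans ?_ h
  simp only [pairing]
  congr 2
  funext p
  rw [dy_dy_tensor_wave]
  simp only [tensor]
  congr 1
  ring

/-- Dominated convergence for pairings. -/
theorem tendsto_pairing (u : L2X 𝕜) (T : C(AddCircle (2 * Real.pi), ℝ)) {f : ℕ → ℝ → ℝ}
    {g b : ℝ → ℝ} (hf : ∀ j, Continuous (f j)) (hb : MemLp b 2) (hfb : ∀ j x, |f j x| ≤ b x)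
    (hlim : ∀ x, Filter.Tendsto (fun j => f j x) Filter.atTop (nhds (g x))) :
    Filter.Tendsto (fun j => pairing u (f j) T) Filter.atTop (nhds (pairing u g T)) := by
  refine tendsto_integral_of_dominated_convergence (fun p => ‖tensor b T p • u p‖) ?_
    (integrable_tensor_smul u hb T).norm ?_ ?_
  · intro j
    refine AEStronglyMeasurable.smul ?_ (Lp.aestronglyMeasurable u)
    exact Continuous.aestronglyMeasurable
      (((hf j).comp continuous_fst).mul (T.continuous.comp continuous_snd))
  · intro j
    refine Filter.Eventually.of_forall fun p => ?_
    rw [norm_smul, norm_smul]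
    refine mul_le_mul_of_nonneg_right ?_ (norm_nonneg _)
    simp only [tensor, norm_mul]
    refine mul_le_mul_of_nonneg_right ?_ (norm_nonneg _)
    exact (hfb j p.1).trans (le_abs_self _)
  · exact Filter.Eventually.of_forall fun p =>
      (((hlim p.1).mul_const _).smul_const _)

/-- The eigenvalue equation holds against product functions that decay together with their
derivatives. -/
theorem pairing_weak {V : C(ℝ, ℝ)} {E : 𝕜} {u : L20 𝕜}
    (hu : u ∈ eigenspace (operator 𝕜 V) E) {f : ℝ → ℝ} (hf : ContDiff ℝ ∞ f)
    (h0 : MemLp f 2) (h1 : MemLp (deriv f) 2) (h2 : MemLp (deriv (deriv f)) 2)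
    (hV : MemLp (fun x => V x * f x) 2) (n : ℕ) (θ : ℝ) :
    pairing (u : L2X 𝕜) (deriv (deriv f)) (wave n θ)
        + (-(n : ℝ) ^ 2) • pairing (u : L2X 𝕜) (fun x => V x * f x) (wave n θ)
      = -(E * pairing (u : L2X 𝕜) f (wave n θ)) := by
  -- The test function f is truncated to χ(εx)f(x) with ε = 1/(j + 1) tending to 0. Derivatives
  -- falling on the cutoff carry a factor ε and disappear in the limit, and ε ≤ 1 gives a dominating
  -- function independent of j.
  let χ : ContDiffBump (0 : ℝ) := ⟨1, 2, by norm_num, by norm_num⟩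
  have hf1 : ContDiff ℝ ∞ (deriv f) := (contDiff_infty_iff_deriv.1 hf).2
  have hf2 : ContDiff ℝ ∞ (deriv (deriv f)) := (contDiff_infty_iff_deriv.1 hf1).2
  have hχ : ContDiff ℝ ∞ χ := χ.contDiff
  have hχ1 : ContDiff ℝ ∞ (deriv χ) := (contDiff_infty_iff_deriv.1 hχ).2
  have hχ2 : ContDiff ℝ ∞ (deriv (deriv χ)) := (contDiff_infty_iff_deriv.1 hχ1).2
  have hχb : ∀ x, |χ x| ≤ 1 := fun x => by
    rw [abs_of_nonneg χ.nonneg]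
    exact χ.le_one
  obtain ⟨B1, hB1⟩ := χ.hasCompactSupport.deriv.exists_bound_of_continuous hχ1.continuous
  obtain ⟨B2, hB2⟩ := χ.hasCompactSupport.deriv.deriv.exists_bound_of_continuous hχ2.continuous
  have hB1' : 0 ≤ B1 := (norm_nonneg _).trans (hB1 0)
  have hB2' : 0 ≤ B2 := (norm_nonneg _).trans (hB2 0)
  let ε : ℕ → ℝ := fun j => 1 / ((j : ℝ) + 1)
  have hε0 : ∀ j, 0 < ε j := fun j => by positivity
  have hε1 : ∀ j, ε j ≤ 1 := fun j => by
    rw [div_le_one (by positivity)]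
    have : (0 : ℝ) ≤ j := j.cast_nonneg
    linarith
  have hε : Filter.Tendsto ε Filter.atTop (nhds 0) := tendsto_one_div_add_atTop_nhds_zero_nat
  let F : ℕ → ℝ → ℝ := fun j x => χ (ε j * x) * f x
  have hscale : ∀ (ψ : ℝ → ℝ), ContDiff ℝ ∞ ψ → ∀ j x,
      HasDerivAt (fun x => ψ (ε j * x)) (ε j * deriv ψ (ε j * x)) x := by
    intro ψ hψ j x
    have ha : HasDerivAt (fun x : ℝ => ε j * x) (ε j) x := by
      simpa using (hasDerivAt_id x).const_mul (ε j)
    refine (((hψ.differentiable (by simp)) (ε j * x)).hasDerivAt.comp x ha).congr_deriv ?_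
    ring
  have hd1 : ∀ j, deriv (F j)
      = fun x => ε j * deriv χ (ε j * x) * f x + χ (ε j * x) * deriv f x := fun j => by
    funext x
    exact ((hscale χ hχ j x).mul ((hf.differentiable (by simp)) x).hasDerivAt).deriv
  have hd2 : ∀ j, deriv (deriv (F j)) = fun x => ε j ^ 2 * deriv (deriv χ) (ε j * x) * f x
      + 2 * ε j * deriv χ (ε j * x) * deriv f x + χ (ε j * x) * deriv (deriv f) x := fun j => by
    rw [hd1]
    funext x
    have ha := (((hscale _ hχ1 j x).const_mul (ε j)).mul
      ((hf.differentiable (by simp)) x).hasDerivAt).add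
      ((hscale χ hχ j x).mul ((hf1.differentiable (by simp)) x).hasDerivAt)
    refine ha.deriv.trans ?_
    ring
  have hFsmooth : ∀ j, ContDiff ℝ ∞ (F j) := fun j =>
    (hχ.comp (contDiff_const.mul contDiff_id)).mul hf
  have hFcomp : ∀ j, HasCompactSupport (F j) := fun j =>
    (χ.hasCompactSupport.comp_homeomorph (Homeomorph.mulLeft₀ (ε j) (hε0 j).ne')).mul_right
  have hεx : ∀ x, Filter.Tendsto (fun j => ε j * x) Filter.atTop (nhds 0) := fun x => by
    simpa using hε.mul_const x
  have hχlim : ∀ x, Filter.Tendsto (fun j => χ (ε j * x)) Filter.atTop (nhds 1) := fun x => by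
    have h3 : χ 0 = 1 := χ.one_of_mem_closedBall (by simp [χ])
    rw [← h3]
    exact (hχ.continuous.tendsto 0).comp (hεx x)
  have hweak := fun j => pairing_weak_of_hasCompactSupport hu (hFsmooth j) (hFcomp j) n θ
  have l0 := tendsto_pairing (u : L2X 𝕜) (wave n θ) (f := F) (g := f) (b := fun x => |f x|)
    (fun j => (hFsmooth j).continuous) h0.norm (fun j x => by
      simp only [F]
      rw [abs_mul]
      exact mul_le_of_le_one_left (abs_nonneg _) (hχb _))
    (fun x => by simpa using (hχlim x).mul_const (f x))
  have lV := tendsto_pairing (u : L2X 𝕜) (wave n θ) (f := fun j x => V x * F j x)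
    (g := fun x => V x * f x) (b := fun x => |V x * f x|)
    (fun j => V.continuous.mul (hFsmooth j).continuous) hV.norm (fun j x => by
      simp only [F]
      rw [mul_left_comm, abs_mul]
      exact mul_le_of_le_one_left (abs_nonneg _) (hχb _))
    (fun x => by simpa using ((hχlim x).mul_const (f x)).const_mul (V x))
  have l2 := tendsto_pairing (u : L2X 𝕜) (wave n θ) (f := fun j => deriv (deriv (F j)))
    (g := deriv (deriv f))
    (b := fun x => B2 * |f x| + 2 * B1 * |deriv f x| + |deriv (deriv f) x|)
    (fun j => (contDiff_infty_iff_deriv.1 (contDiff_infty_iff_deriv.1 (hFsmooth j)).2).2.continuous)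
    (((h0.norm.const_mul B2).add (h1.norm.const_mul (2 * B1))).add h2.norm) (fun j x => by
      rw [hd2]
      refine (abs_add_le _ _).trans (add_le_add ((abs_add_le _ _).trans (add_le_add ?_ ?_)) ?_)
      · rw [abs_mul, abs_mul, abs_pow, abs_of_pos (hε0 j)]
        refine mul_le_mul_of_nonneg_right ?_ (abs_nonneg _)
        exact (mul_le_of_le_one_left (abs_nonneg _)
          (pow_le_one₀ (hε0 j).le (hε1 j))).trans (hB2 _)
      · rw [abs_mul, abs_mul, abs_mul, abs_of_pos (hε0 j), abs_two]
        refine mul_le_mul_of_nonneg_right ?_ (abs_nonneg _)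
        rw [mul_assoc]
        refine mul_le_mul_of_nonneg_left ?_ zero_le_two
        exact (mul_le_of_le_one_left (abs_nonneg _) (hε1 j)).trans (hB1 _)
      · rw [abs_mul]
        exact mul_le_of_le_one_left (abs_nonneg _) (hχb _))
    (fun x => by
      simp only [hd2]
      have e1 : Filter.Tendsto (fun j => deriv χ (ε j * x)) Filter.atTop (nhds (deriv χ 0)) :=
        (hχ1.continuous.tendsto 0).comp (hεx x)
      have e2 : Filter.Tendsto (fun j => deriv (deriv χ) (ε j * x)) Filter.atTop
          (nhds (deriv (deriv χ) 0)) := (hχ2.continuous.tendsto 0).comp (hεx x)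
      have := (((((hε.pow 2).mul e2).mul_const (f x))).add
        (((hε.const_mul 2).mul e1).mul_const (deriv f x))).add
        ((hχlim x).mul_const (deriv (deriv f) x))
      simpa using this)
  exact tendsto_nhds_unique ((l2.add (lV.const_smul (-(n : ℝ) ^ 2))).congr hweak)
    ((l0.const_mul E).neg)

end

section
variable {𝕜 : Type*} [RCLike 𝕜]

/-! ### Integration by parts against test functions -/

theorem IsTest.hasDerivAt_dx {φ : Cylinder → ℝ} (h : IsTest φ) (x : ℝ)
    (y : AddCircle (2 * Real.pi)) : HasDerivAt (fun x => φ (x, y)) (Grushin.dx φ (x, y)) x := by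
  induction y using QuotientAddGroup.induction_on with
  | H y =>
    have h1 : DifferentiableAt ℝ (fun t : ℝ => φ (cover (t, y))) x :=
      ((h.smooth.differentiable (by simp)) (x, y)).comp x (f := fun t : ℝ => (t, y)) (by fun_prop)
    exact h1.hasDerivAt

theorem IsTest.hasDerivAt_dy {φ : Cylinder → ℝ} (h : IsTest φ) (x y : ℝ) :
    HasDerivAt (fun y : ℝ => φ (x, (y : AddCircle (2 * Real.pi))))
      (Grushin.dy φ (x, (y : AddCircle (2 * Real.pi)))) y := by
  have h1 : DifferentiableAt ℝ (fun t : ℝ => φ (cover (x, t))) y :=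
    ((h.smooth.differentiable (by simp)) (x, y)).comp y (f := fun t : ℝ => (x, t)) (by fun_prop)
  refine h1.hasDerivAt.congr_deriv ?_
  exact ((deriv_comp_const_add (fun t : ℝ => φ (cover (x, t))) y 0).trans (by rw [add_zero])).symm

theorem IsTest.hasCompactSupport_slice {φ : Cylinder → ℝ} (h : IsTest φ)
    (y : AddCircle (2 * Real.pi)) : HasCompactSupport fun x => φ (x, y) :=
  HasCompactSupport.intro (h.compact.isCompact.image continuous_fst) fun x hx =>
    image_eq_zero_of_notMem_tsupport fun hm => hx ⟨(x, y), hm, rfl⟩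

theorem IsTest.integral_dx_mul {φ : Cylinder → ℝ} (h : IsTest φ) {f f' : ℝ → ℝ}
    (hf : ∀ x, HasDerivAt f (f' x) x) (hf' : Continuous f') (y : AddCircle (2 * Real.pi)) :
    ∫ x, Grushin.dx φ (x, y) * f x = -∫ x, φ (x, y) * f' x := by
  have hfc : Continuous f := continuous_iff_continuousAt.2 fun x => (hf x).continuousAt
  have hs : Continuous fun x : ℝ => ((x, y) : Cylinder) := by fun_prop
  have hi : ∀ {ψ : Cylinder → ℝ}, IsTest ψ → ∀ {g : ℝ → ℝ}, Continuous g →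
      Integrable fun x => ψ (x, y) * g x := fun {ψ} (hψ : IsTest ψ) {g} (hg : Continuous g) =>
    ((hψ.continuous.comp hs).mul hg).integrable_of_hasCompactSupport
      (hψ.hasCompactSupport_slice y).mul_right
  rw [integral_mul_deriv_eq_deriv_mul_of_integrable (fun x _ => h.hasDerivAt_dx x y)
    (fun x _ => hf x)    (hi h hf') (hi h.dx hfc) (hi h hfc), neg_neg]

/-- Integration by parts on the circle. -/
theorem integral_circle_by_parts {F F' G G' : AddCircle (2 * Real.pi) → ℝ}
    (hF : ∀ y : ℝ, HasDerivAt (fun y : ℝ => F y) (F' y) y)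
    (hG : ∀ y : ℝ, HasDerivAt (fun y : ℝ => G y) (G' y) y)
    (hF' : Continuous F') (hG' : Continuous G') :
    ∫ y, F' y * G y = -∫ y, F y * G' y := by
  have hc : Continuous fun y : ℝ => (y : AddCircle (2 * Real.pi)) := AddCircle.continuous_mk' _
  rw [← AddCircle.intervalIntegral_preimage (2 * Real.pi) 0,
    ← AddCircle.intervalIntegral_preimage (2 * Real.pi) 0,
    intervalIntegral.integral_mul_deriv_eq_deriv_mul (fun y _ => hF y) (fun y _ => hG y)
      ((hF'.comp hc).intervalIntegrable _ _) ((hG'.comp hc).intervalIntegrable _ _)]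
  have h1 : ((0 + 2 * Real.pi : ℝ) : AddCircle (2 * Real.pi)) = ((0 : ℝ) : AddCircle _) := by
    rw [zero_add, AddCircle.coe_period, AddCircle.coe_zero]
  simp only [h1]
  ring

theorem IsTest.integral_dy_mul_wave {φ : Cylinder → ℝ} (h : IsTest φ) (n : ℕ) (θ x : ℝ) :
    ∫ y, Grushin.dy φ (x, y) * wave n θ y = -∫ y, φ (x, y) * (n * wave n (θ + Real.pi / 2) y) :=
  integral_circle_by_parts (fun y => h.hasDerivAt_dy x y) (fun y => hasDerivAt_wave n θ y)
    (h.dy.continuous.comp (by fun_prop))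
    (continuous_const.mul (wave n (θ + Real.pi / 2)).continuous)

theorem IsTest.integral_dy_dy_mul_wave {φ : Cylinder → ℝ} (h : IsTest φ) (n : ℕ) (θ x : ℝ) :
    ∫ y, Grushin.dy (Grushin.dy φ) (x, y) * wave n θ y
      = ∫ y, φ (x, y) * (-(n : ℝ) ^ 2 * wave n θ y) := by
  have h1 : ∀ y : AddCircle (2 * Real.pi), Grushin.dy φ (x, y) * (n * wave n (θ + Real.pi / 2) y)
      = n * (Grushin.dy φ (x, y) * wave n (θ + Real.pi / 2) y) := fun y => by ring
  rw [h.dy.integral_dy_mul_wave, integral_congr_ae (Filter.Eventually.of_forall h1),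
    integral_const_mul, h.integral_dy_mul_wave, mul_neg, neg_neg, ← integral_const_mul]
  refine integral_congr_ae (Filter.Eventually.of_forall fun y => ?_)
  simp only [wave_add_pi]
  ring

theorem IsTest.integrable_mul_tensor {φ : Cylinder → ℝ} (h : IsTest φ) {f : ℝ → ℝ}
    (hf : Continuous f) (T : C(AddCircle (2 * Real.pi), ℝ)) :
    Integrable fun p => φ p * tensor f T p :=
  (h.continuous.mul ((hf.comp continuous_fst).mul
    (T.continuous.comp continuous_snd))).integrable_of_hasCompactSupport h.compact.mul_right

theorem IsTest.integral_dx_dx_mul_tensor {φ : Cylinder → ℝ} (h : IsTest φ) {f : ℝ → ℝ}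
    (hf : ContDiff ℝ ∞ f) (T : C(AddCircle (2 * Real.pi), ℝ)) :
    ∫ p, Grushin.dx (Grushin.dx φ) p * tensor f T p = ∫ p, φ p * tensor (deriv (deriv f)) T p := by
  have hf1 : ContDiff ℝ ∞ (deriv f) := (contDiff_infty_iff_deriv.1 hf).2
  have hf2 : ContDiff ℝ ∞ (deriv (deriv f)) := (contDiff_infty_iff_deriv.1 hf1).2
  refine (integral_prod_symm (μ := volume) (ν := volume) _
    (h.dx.dx.integrable_mul_tensor hf.continuous T)).trans (Eq.trans ?_
    (integral_prod_symm (μ := volume) (ν := volume) _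
      (h.integrable_mul_tensor hf2.continuous T)).symm)
  refine integral_congr_ae (Filter.Eventually.of_forall fun y => ?_)
  simp only [tensor, ← mul_assoc]
  rw [integral_mul_const, integral_mul_const,
    h.dx.integral_dx_mul (fun x => (hf.differentiable (by simp) x).hasDerivAt) hf1.continuous,
    h.integral_dx_mul (fun x => (hf1.differentiable (by simp) x).hasDerivAt) hf2.continuous,
    neg_neg]

theorem IsTest.integral_dy_dy_mul_tensor {φ : Cylinder → ℝ} (h : IsTest φ) (V : C(ℝ, ℝ))
    {f : ℝ → ℝ} (hf : Continuous f) (n : ℕ) (θ : ℝ) :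
    ∫ p, V p.1 * Grushin.dy (Grushin.dy φ) p * tensor f (wave n θ) p
      = ∫ p, φ p * tensor (fun x => -(n : ℝ) ^ 2 * (V x * f x)) (wave n θ) p := by
  have h1 : ∀ p : Cylinder, V p.1 * Grushin.dy (Grushin.dy φ) p * tensor f (wave n θ) p
      = Grushin.dy (Grushin.dy φ) p * tensor (fun x => V x * f x) (wave n θ) p := fun p => by
    simp only [tensor]
    ring
  rw [integral_congr_ae (Filter.Eventually.of_forall h1)]
  have hVf : Continuous fun x => V x * f x := V.continuous.mul hf
  refine (integral_prod (μ := volume) (ν := volume) _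
    (h.dy.dy.integrable_mul_tensor hVf _)).trans (Eq.trans ?_
    (integral_prod (μ := volume) (ν := volume) _
      (h.integrable_mul_tensor (continuous_const.mul hVf) _)).symm)
  refine integral_congr_ae (Filter.Eventually.of_forall fun x => ?_)
  have e1 : ∀ y, Grushin.dy (Grushin.dy φ) (x, y) * tensor (fun x => V x * f x) (wave n θ) (x, y)
      = V x * f x * (Grushin.dy (Grushin.dy φ) (x, y) * wave n θ y) := fun y => by
    simp only [tensor]
    ring
  have e2 : ∀ y, φ (x, y) * tensor (fun x => -(n : ℝ) ^ 2 * (V x * f x)) (wave n θ) (x, y)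
      = V x * f x * (φ (x, y) * (-(n : ℝ) ^ 2 * wave n θ y)) := fun y => by
    simp only [tensor]
    ring
  refine (integral_congr_ae (Filter.Eventually.of_forall e1)).trans (Eq.trans ?_
    (integral_congr_ae (Filter.Eventually.of_forall e2)).symm)
  rw [integral_const_mul, integral_const_mul, h.integral_dy_dy_mul_wave]

/-! ### Product eigenfunctions -/

variable (𝕜) in
/-- The function `f(x) cos (n y + θ)` as an element of `L²`. -/
def mode {f : ℝ → ℝ} (hf : MemLp f 2) (n : ℕ) (θ : ℝ) : L2X 𝕜 :=
  ((memLp_tensor hf (wave n θ)).ofReal (K := 𝕜)).toLp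

theorem coeFn_mode {f : ℝ → ℝ} (hf : MemLp f 2) (n : ℕ) (θ : ℝ) :
    mode 𝕜 hf n θ =ᵐ[volume] fun p => ((tensor f (wave n θ) p : ℝ) : 𝕜) :=
  MemLp.coeFn_toLp _

theorem integral_smul_mode {f : ℝ → ℝ} (hf : MemLp f 2) (n : ℕ) (θ : ℝ) (φ : Cylinder → ℝ) :
    ∫ p, φ p • mode 𝕜 hf n θ p = ((∫ p, φ p * tensor f (wave n θ) p : ℝ) : 𝕜) := by
  rw [← integral_ofReal]
  refine integral_congr_ae ?_
  filter_upwards [coeFn_mode (𝕜 := 𝕜) hf n θ] with p hp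
  rw [hp, RCLike.real_smul_eq_coe_mul, RCLike.ofReal_mul]

theorem isWeakDxx_mode {f : ℝ → ℝ} (hf : ContDiff ℝ ∞ f) (h0 : MemLp f 2)
    (h2 : MemLp (deriv (deriv f)) 2) (n : ℕ) (θ : ℝ) :
    IsWeakDxx (mode 𝕜 h0 n θ) (mode 𝕜 h2 n θ) := fun φ hφ => by
  rw [integral_smul_mode, integral_smul_mode, hφ.integral_dx_dx_mul_tensor hf]

theorem isWeakVDyy_mode {f : ℝ → ℝ} (V : C(ℝ, ℝ)) (hf : Continuous f) (h0 : MemLp f 2)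
    {n : ℕ} (hV : MemLp (fun x => -(n : ℝ) ^ 2 * (V x * f x)) 2) (θ : ℝ) :
    IsWeakVDyy V (mode 𝕜 h0 n θ) (mode 𝕜 hV n θ) := fun φ hφ => by
  rw [integral_smul_mode, integral_smul_mode, hφ.integral_dy_dy_mul_tensor V hf]

/-- For n > 0 a mode is itself a second y-derivative: with the constant potential -1/n² it is V ∂_y²
of itself, and such weak derivatives always lie in L²₀. -/
theorem mode_mem_L20 {f : ℝ → ℝ} (hf : Continuous f) (h0 : MemLp f 2) {n : ℕ} (hn : 0 < n)
    (θ : ℝ) : mode 𝕜 h0 n θ ∈ L20 𝕜 := by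
  have hn' : (n : ℝ) ≠ 0 := Nat.cast_ne_zero.2 hn.ne'
  let V : C(ℝ, ℝ) := ContinuousMap.const ℝ (-((n : ℝ) ^ 2)⁻¹)
  have h1 : (fun x => -(n : ℝ) ^ 2 * (V x * f x)) = f := by
    funext x
    simp only [V, ContinuousMap.const_apply]
    field_simp
  have h2 : MemLp (fun x => -(n : ℝ) ^ 2 * (V x * f x)) 2 := by rwa [h1]
  have h3 := (isWeakVDyy_mode (𝕜 := 𝕜) V hf h0 h2 θ).mem_L20
  convert h3 using 2
  exact h1.symm

theorem mode_mem_eigenspace {V : C(ℝ, ℝ)} {f : ℝ → ℝ} (hf : ContDiff ℝ ∞ f) (h0 : MemLp f 2)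
    (h2 : MemLp (deriv (deriv f)) 2) (hV : MemLp (fun x => V x * f x) 2) {n : ℕ} (hn : 0 < n)
    (θ : ℝ) {E : ℝ} (hE : ∀ x, deriv (deriv f) x = (n : ℝ) ^ 2 * (V x * f x) - E * f x) :
    (⟨mode 𝕜 h0 n θ, mode_mem_L20 hf.continuous h0 hn θ⟩ : L20 𝕜)
      ∈ eigenspace (operator 𝕜 V) (E : 𝕜) := by
  have hV' := hV.const_mul (-(n : ℝ) ^ 2)
  have hg := isWeakDxx_mode (𝕜 := 𝕜) hf h0 h2 n θ
  have hh := isWeakVDyy_mode (𝕜 := 𝕜) V hf.continuous h0 hV' θ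
  refine ⟨⟨⟨_, hg⟩, ⟨_, hh⟩⟩, ?_⟩
  apply Subtype.ext
  rw [operator_apply _ hg hh]
  change _ = (E : 𝕜) • mode 𝕜 h0 n θ
  apply Lp.ext
  filter_upwards [coeFn_mode (𝕜 := 𝕜) h0 n θ, coeFn_mode (𝕜 := 𝕜) h2 n θ,
    coeFn_mode (𝕜 := 𝕜) hV' n θ, Lp.coeFn_sub (-mode 𝕜 h2 n θ) (mode 𝕜 hV' n θ),
    Lp.coeFn_neg (mode 𝕜 h2 n θ), Lp.coeFn_smul (E : 𝕜) (mode 𝕜 h0 n θ)]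
    with p e1 e2 e3 e4 e5 e6
  rw [e4, e6, Pi.sub_apply, e5, Pi.neg_apply, Pi.smul_apply, e1, e2, e3, smul_eq_mul]
  simp only [tensor, hE]
  push_cast
  ring

end

/-! ### Hermite polynomials and energy levels -/

/-- The eigenvalues of `P_s`. -/
def level (s : ℝ) (n k : ℕ) : ℝ := (n : ℝ) ^ 2 * s ^ 2 + n * (2 * k + 1)

/-- Equality of two levels reads (n² - m²)s² = integer, which forces n² = m² by irrationality; the
remaining term n(2k + 1) then determines k. This is the only place where the arithmetic of s²
enters. -/
theorem level_injective {s : ℝ} (hs : Irrational (s ^ 2)) {n m k l : ℕ} (hn : 0 < n)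
    (h : level s n k = level s m l) : n = m ∧ k = l := by
  have h1 : ((n : ℝ) ^ 2 - (m : ℝ) ^ 2) * s ^ 2 = m * (2 * l + 1) - n * (2 * k + 1) := by
    simp only [level] at h
    linarith
  have h2 : (n : ℝ) ^ 2 - (m : ℝ) ^ 2 = 0 := by
    by_contra h0
    refine hs ⟨((m : ℚ) * (2 * l + 1) - n * (2 * k + 1)) / ((n : ℚ) ^ 2 - (m : ℚ) ^ 2), ?_⟩
    push_cast
    rw [← h1, mul_div_cancel_left₀ _ h0]
  have h3 : n = m := by
    have h4 : (n : ℝ) ^ 2 = (m : ℝ) ^ 2 := by linarith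
    exact_mod_cast (pow_left_inj₀ n.cast_nonneg m.cast_nonneg two_ne_zero).1 h4
  subst h3
  refine ⟨rfl, ?_⟩
  rw [sub_self, zero_mul] at h1
  have hn' : (0 : ℝ) < n := Nat.cast_pos.2 hn
  have h5 : (n : ℝ) * (l - k) = 0 := by linarith
  have h6 : (l : ℝ) - k = 0 := (mul_eq_zero.1 h5).resolve_left hn'.ne'
  exact_mod_cast (sub_eq_zero.1 h6).symm

open Polynomial in
/-- Existence of (rescaled) Hermite polynomials. -/
theorem exists_hermite {c : ℝ} (hc : c ≠ 0) (k : ℕ) :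
    ∃ p : ℝ[X], p ≠ 0 ∧
      derivative (derivative p) = C (2 * c) * X * derivative p - C (2 * c * k) * p := by
  induction k with
  | zero => exact ⟨1, one_ne_zero, by simp⟩
  | succ k ih =>
    obtain ⟨p, hp, h⟩ := ih
    -- The raising operator p ↦ 2cXp - p' produces the next Hermite polynomial; differentiating it
    -- returns a multiple of p.
    have h2 : derivative (C (2 * c) * X * p - derivative p) = C (2 * c * (k + 1)) * p := by
      rw [derivative_sub, h, derivative_mul, derivative_mul, derivative_C, derivative_X]
      simp only [C_mul, C_add, C_1]
      ring
    refine ⟨C (2 * c) * X * p - derivative p, fun h0 => ?_, ?_⟩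
    -- If the raised polynomial vanished, 2cXp would equal p', which has degree below that of p.
    · have h3 : p.degree < p.degree := by
        calc p.degree ≤ (C (2 * c) * X * p).degree := by
              rw [degree_mul, degree_C_mul_X (mul_ne_zero two_ne_zero hc)]
              exact le_add_of_nonneg_left zero_le_one
          _ = (derivative p).degree := by rw [sub_eq_zero.1 h0]
          _ < p.degree := degree_derivative_lt hp
      exact h3.false
    · rw [h2, derivative_C_mul]
      simp only [C_mul, C_add, C_1, Nat.cast_add, Nat.cast_one]
      ring

open Polynomial in
theorem exists_hermite_function {n : ℕ} (hn : 0 < n) (s : ℝ) (k : ℕ) :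
    ∃ p : ℝ[X], p ≠ 0 ∧ ∀ x, deriv (deriv (polyGauss n p)) x
      = (n : ℝ) ^ 2 * (potential s x * polyGauss n p x) - level s n k * polyGauss n p x := by
  obtain ⟨p, hp, h⟩ := exists_hermite (c := n) (Nat.cast_ne_zero.2 hn.ne') k
  refine ⟨p, hp, fun x => ?_⟩
  rw [deriv_polyGauss, deriv_polyGauss, gaussDeriv_gaussDeriv, h]
  simp only [polyGauss, level, potential, ContinuousMap.coe_mk, eval_add, eval_sub, eval_mul,
    eval_C, eval_X, eval_pow]
  ring

open Polynomial in
theorem integral_polyGauss_sq_pos {c : ℝ} (hc : 0 < c) {p : ℝ[X]} (hp : p ≠ 0) :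
    0 < ∫ x, polyGauss c p x ^ 2 := by
  obtain ⟨x, hx⟩ : ∃ x, p.eval x ≠ 0 := by
    by_contra! h0
    exact hp (Polynomial.funext fun x => by rw [h0, eval_zero])
  have hcont : Continuous fun x => polyGauss c p x ^ 2 := (continuous_polyGauss c p).pow 2
  rw [integral_pos_iff_support_of_nonneg (fun x => sq_nonneg _) (memLp_polyGauss hc p).integrable_sq]
  exact hcont.isOpen_support.measure_pos _
    ⟨x, pow_ne_zero 2 (mul_ne_zero hx (Real.exp_ne_zero _))⟩

section
variable {𝕜 : Type*} [RCLike 𝕜]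

/-! ### Moments of eigenfunctions -/

open Polynomial in
theorem memLp_potential_mul_polyGauss {c : ℝ} (hc : 0 < c) (s : ℝ) (p : ℝ[X]) :
    MemLp (fun x => potential s x * polyGauss c p x) 2 := by
  convert memLp_polyGauss hc ((X ^ 2 + C (s ^ 2)) * p) using 2 with x
  simp [potential, polyGauss, mul_assoc]

open Polynomial in
theorem memLp_deriv_deriv_polyGauss {c : ℝ} (hc : 0 < c) (p : ℝ[X]) :
    MemLp (deriv (deriv (polyGauss c p))) 2 := by
  rw [deriv_polyGauss, deriv_polyGauss]
  exact memLp_polyGauss hc _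

open Polynomial in
/-- The moments of an eigenfunction satisfy a two-term recursion. -/
theorem pairing_recursion {s : ℝ} {E : 𝕜} {u : L20 𝕜} (hu : u ∈ eigenspace (P 𝕜 s) E)
    {n : ℕ} (hn : 0 < n) (θ : ℝ) (k : ℕ) :
    (E - (level s n k : 𝕜)) * pairing (u : L2X 𝕜) (polyGauss n (X ^ k)) (wave n θ)
      = -((k * (k - 1) : ℝ) • pairing (u : L2X 𝕜) (polyGauss n (X ^ (k - 2))) (wave n θ)) := by
  have hc : (0 : ℝ) < n := Nat.cast_pos.2 hn
  have h := pairing_weak hu (contDiff_polyGauss n (X ^ k)) (memLp_polyGauss hc _)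
    (by rw [deriv_polyGauss]; exact memLp_polyGauss hc _) (memLp_deriv_deriv_polyGauss hc _)
    (memLp_potential_mul_polyGauss hc s _) n θ
  have h1 : deriv (deriv (polyGauss n (X ^ k))) = fun x =>
      (((k * (k - 1) : ℝ) * polyGauss n (X ^ (k - 2)) x)
        + (n : ℝ) ^ 2 * (potential s x * polyGauss n (X ^ k) x))
        + (-level s n k) * polyGauss n (X ^ k) x := by
    funext x
    rw [deriv_polyGauss, deriv_polyGauss, gaussDeriv_gaussDeriv]
    simp only [polyGauss, level, potential, ContinuousMap.coe_mk, eval_add, eval_sub, eval_mul,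
      eval_C, eval_X, eval_pow]
    -- The exponent k - 2 is truncated for k = 0 and k = 1, where the coefficient k(k - 1) vanishes.
    rcases k with _ | _ | k
    · simp
      ring
    · simp
      ring
    · simp
      ring
  have m1 : MemLp (fun x => (k * (k - 1) : ℝ) * polyGauss n (X ^ (k - 2)) x) 2 := (memLp_polyGauss hc (X ^ (k - 2))).const_mul (k * (k - 1) : ℝ)
  have m2 : MemLp (fun x => (n : ℝ) ^ 2 * (potential s x * polyGauss n (X ^ k) x)) 2 :=
    (memLp_potential_mul_polyGauss hc s (X ^ k)).const_mul ((n : ℝ) ^ 2)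
  have m3 : MemLp (fun x => -level s n k * polyGauss n (X ^ k) x) 2 :=
    (memLp_polyGauss hc (X ^ k)).const_mul (-level s n k)
  have m4 : MemLp (fun x => (k * (k - 1) : ℝ) * polyGauss n (X ^ (k - 2)) x
      + (n : ℝ) ^ 2 * (potential s x * polyGauss n (X ^ k) x)) 2 := m1.add m2
  rw [h1, pairing_add _ m4 m3, pairing_add _ m1 m2, pairing_const_mul, pairing_const_mul,
    pairing_const_mul] at h
  simp only [RCLike.real_smul_eq_coe_mul, RCLike.ofReal_neg] at h ⊢
  linear_combination h

-- Away from resonance the factor E - level can be divided out of the recursion, so a moment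
-- vanishes once the one two steps below does; at a resonance it vanishes by hypothesis.
open Polynomial in
theorem pairing_eq_zero {s : ℝ} {E : 𝕜} {u : L20 𝕜} (hu : u ∈ eigenspace (P 𝕜 s) E)
    {n : ℕ} (hn : 0 < n) (θ : ℝ)
    (h : ∀ k : ℕ, E = (level s n k : 𝕜) →
      pairing (u : L2X 𝕜) (polyGauss n (X ^ k)) (wave n θ) = 0) (k : ℕ) :
    pairing (u : L2X 𝕜) (polyGauss n (X ^ k)) (wave n θ) = 0 := by
  induction k using Nat.strong_induction_on with
  | _ k ih =>
    by_cases hk : E = (level s n k : 𝕜)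
    · exact h k hk
    · have h1 := pairing_recursion hu hn θ k
      have h2 : ((k * (k - 1) : ℝ) • pairing (u : L2X 𝕜) (polyGauss n (X ^ (k - 2))) (wave n θ))
          = 0 := by
        rcases k with _ | _ | k
        · simp
        · simp
        · rw [ih _ (by omega), smul_zero]
      rw [h2, neg_zero] at h1
      exact (mul_eq_zero.1 h1).resolve_left (sub_ne_zero.2 hk)

-- An eigenfunction is thus determined by its resonant moments, two for each pair (n, k) with E
-- equal to the level. This bounds the multiplicity by twice the number of such pairs.
open Polynomial in
theorem eq_zero_of_resonant_pairing {s : ℝ} {E : 𝕜} {u : L20 𝕜}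
    (hu : u ∈ eigenspace (P 𝕜 s) E)
    (h : ∀ n k : ℕ, 0 < n → E = (level s n k : 𝕜) →
      pairing (u : L2X 𝕜) (polyGauss n (X ^ k)) (wave n 0) = 0 ∧
      pairing (u : L2X 𝕜) (polyGauss n (X ^ k)) (wave n (-(Real.pi / 2))) = 0) : u = 0 := by
  apply Subtype.ext
  refine eq_zero_of_pairing fun n => ?_
  rcases Nat.eq_zero_or_pos n with rfl | hn
  · exact ⟨1, one_pos, fun k => ⟨pairing_wave_zero u.2 (memLp_polyGauss one_pos _) _,
      pairing_wave_zero u.2 (memLp_polyGauss one_pos _) _⟩⟩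
  · exact ⟨n, Nat.cast_pos.2 hn, fun k =>
      ⟨pairing_eq_zero hu hn _ (fun k hk => (h n k hn hk).1) k,
        pairing_eq_zero hu hn _ (fun k hk => (h n k hn hk).2) k⟩⟩

/-- Without a resonant pair the condition in `eq_zero_of_resonant_pairing` is vacuous and the
eigenfunction would be zero. In particular E is real. -/
theorem IsEigenvalue.eq_level {s : ℝ} {E : 𝕜} (h : IsEigenvalue (P 𝕜 s) E) :
    ∃ n k : ℕ, 0 < n ∧ E = (level s n k : 𝕜) := by
  obtain ⟨u, hu, h0⟩ := h
  by_contra! hc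
  exact h0 (eq_zero_of_resonant_pairing hu fun n k hn hk => absurd hk (hc n k hn))

open Polynomial in
/-- The eigenspace of a level has dimension at most two. -/
theorem finrank_eigenspace_le {s : ℝ} (hs : Irrational (s ^ 2)) {n : ℕ} (hn : 0 < n) (k : ℕ) :
    Module.Finite 𝕜 (eigenspace (P 𝕜 s) (level s n k : 𝕜)) ∧
      Module.finrank 𝕜 (eigenspace (P 𝕜 s) (level s n k : 𝕜)) ≤ 2 := by
  have hm := memLp_polyGauss (Nat.cast_pos.2 hn : (0 : ℝ) < n) (X ^ k)
  let ℓ : eigenspace (P 𝕜 s) (level s n k : 𝕜) →ₗ[𝕜] 𝕜 × 𝕜 :=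
    { toFun := fun u => (pairing ((u : L20 𝕜) : L2X 𝕜) (polyGauss n (X ^ k)) (wave n 0),
        pairing ((u : L20 𝕜) : L2X 𝕜) (polyGauss n (X ^ k)) (wave n (-(Real.pi / 2))))
      map_add' := fun u v => Prod.ext (pairing_add_left _ _ hm _) (pairing_add_left _ _ hm _)
      map_smul' := fun r u => Prod.ext (pairing_smul_left _ _ _ _) (pairing_smul_left _ _ _ _) }
  -- By `level_injective` the pair (n, k) is the only resonant one, so these two moments determine
  -- u.
  have hℓ : Function.Injective ℓ := by
    rw [injective_iff_map_eq_zero]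
    intro u hu
    apply Subtype.ext
    refine eq_zero_of_resonant_pairing u.2 fun m l _ hml => ?_
    obtain ⟨rfl, rfl⟩ := level_injective hs hn (RCLike.ofReal_injective hml)
    exact ⟨congrArg Prod.fst hu, congrArg Prod.snd hu⟩
  have hfin : Module.Finite 𝕜 (eigenspace (P 𝕜 s) (level s n k : 𝕜)) :=
    Module.Finite.of_injective ℓ hℓ
  refine ⟨hfin, (LinearMap.finrank_le_finrank_of_injective hℓ).trans ?_⟩
  rw [Module.finrank_prod, Module.finrank_self]

end

/-! ### Trigonometric estimates -/

/-- Induction through the addition formula. The factor n will cancel the 1/n coming from integrating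
an oscillation of frequency n. -/
theorem abs_sin_nat_mul_le (n : ℕ) (x : ℝ) : |Real.sin (n * x)| ≤ n * |Real.sin x| := by
  induction n with
  | zero => simp
  | succ n ih =>
    have h1 : ((n + 1 : ℕ) : ℝ) * x = n * x + x := by
      push_cast
      ring
    rw [h1, Real.sin_add]
    calc _ ≤ |Real.sin (n * x) * Real.cos x| + |Real.cos (n * x) * Real.sin x| := abs_add_le _ _
      _ ≤ n * |Real.sin x| + |Real.sin x| := by
        rw [abs_mul, abs_mul]
        refine add_le_add ?_ ?_
        · exact (mul_le_of_le_one_right (abs_nonneg _) (Real.abs_cos_le_one _)).trans ih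
        · exact mul_le_of_le_one_left (abs_nonneg _) (Real.abs_cos_le_one _)
      _ = _ := by
        push_cast
        ring

/-- A trigonometric monomial cannot concentrate away from an interval, uniformly in its
frequency. -/
theorem integral_trig_ge {n : ℕ} (hn : 0 < n) {A B C : ℝ} (hA : 0 ≤ A) (hB : 0 ≤ B)
    (hC : C ^ 2 ≤ A * B) (a b : ℝ) :
    (A + B) * ((b - a - |Real.sin (b - a)|) / 2) ≤
      ∫ y in a..b, (A * Real.cos (n * y) ^ 2 + B * Real.sin (n * y) ^ 2
        + 2 * C * (Real.cos (n * y) * Real.sin (n * y))) := by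
  have hn' : (0 : ℝ) < n := Nat.cast_pos.2 hn
  -- An explicit primitive: the mean (A + B)/2 gives the linear term, and the oscillating part has
  -- frequency 2n. Its increments factor through sin(n(b - a)) by the product formulas `e1` and
  -- `e2`.
  have hd : ∀ y ∈ Set.uIcc a b, HasDerivAt (fun y : ℝ => (A + B) / 2 * y
      + (A - B) / (2 * n) * (Real.sin (n * y) * Real.cos (n * y)) + C / n * Real.sin (n * y) ^ 2)
      (A * Real.cos (n * y) ^ 2 + B * Real.sin (n * y) ^ 2
        + 2 * C * (Real.cos (n * y) * Real.sin (n * y))) y := by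
    intro y _
    have h1 : HasDerivAt (fun y : ℝ => (n : ℝ) * y) n y := by
      simpa using (hasDerivAt_id y).const_mul (n : ℝ)
    have h2 := (((hasDerivAt_id y).const_mul ((A + B) / 2)).add
      ((h1.sin.mul h1.cos).const_mul ((A - B) / (2 * n)))).add ((h1.sin.pow 2).const_mul (C / n))
    refine h2.congr_deriv ?_
    have h3 := Real.sin_sq_add_cos_sq ((n : ℝ) * y)
    field_simp
    push_cast
    linear_combination (A + B) * (-h3)
  rw [intervalIntegral.integral_eq_sub_of_hasDerivAt hd
    (Continuous.intervalIntegrable (by fun_prop) _ _)]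
  set S := Real.sin (n * (b - a)) with hS
  set c := Real.cos (n * (a + b)) with hcdef
  set d := Real.sin (n * (a + b)) with hddef
  have hcd : d ^ 2 + c ^ 2 = 1 := Real.sin_sq_add_cos_sq _
  have e1 : Real.sin (n * b) * Real.cos (n * b) - Real.sin (n * a) * Real.cos (n * a) = S * c := by
    rw [hS, hcdef, mul_sub, mul_add, Real.sin_sub, Real.cos_add]
    have ha := Real.sin_sq_add_cos_sq ((n : ℝ) * a)
    have hb := Real.sin_sq_add_cos_sq ((n : ℝ) * b)
    linear_combination (-Real.sin (n * b) * Real.cos (n * b)) * ha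
      + (Real.sin (n * a) * Real.cos (n * a)) * hb
  have e2 : Real.sin (n * b) ^ 2 - Real.sin (n * a) ^ 2 = S * d := by
    rw [hS, hddef, mul_sub, mul_add, Real.sin_sub, Real.sin_add]
    have ha := Real.sin_sq_add_cos_sq ((n : ℝ) * a)
    have hb := Real.sin_sq_add_cos_sq ((n : ℝ) * b)
    linear_combination (-Real.sin (n * b) ^ 2) * ha + (Real.sin (n * a) ^ 2) * hb
  have e3 : (A + B) / 2 * b + (A - B) / (2 * n) * (Real.sin (n * b) * Real.cos (n * b))
      + C / n * Real.sin (n * b) ^ 2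
      - ((A + B) / 2 * a + (A - B) / (2 * n) * (Real.sin (n * a) * Real.cos (n * a))
      + C / n * Real.sin (n * a) ^ 2)
      = (A + B) / 2 * (b - a) + S / (2 * n) * ((A - B) * c + 2 * C * d) := by
    have : (A + B) / 2 * (b - a) + S / (2 * n) * ((A - B) * c + 2 * C * d)
        = (A + B) / 2 * (b - a) + (A - B) / (2 * n) * (S * c) + C / n * (S * d) := by
      field_simp
      ring
    rw [this, ← e1, ← e2]
    ring
  rw [e3]
  -- Cauchy-Schwarz against the unit vector (c, d), followed by (A - B)² + 4C² ≤ (A + B)², which is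
  -- the hypothesis C² ≤ AB.
  have h1 : |(A - B) * c + 2 * C * d| ≤ A + B := by
    refine abs_le_of_sq_le_sq ?_ (add_nonneg hA hB)
    have h2 : ((A - B) * c + 2 * C * d) ^ 2 + ((A - B) * d - 2 * C * c) ^ 2
        = (A - B) ^ 2 + 4 * C ^ 2 := by
      linear_combination ((A - B) ^ 2 + 4 * C ^ 2) * hcd
    nlinarith [sq_nonneg ((A - B) * d - 2 * C * c)]
  have h3 : |S / (2 * n) * ((A - B) * c + 2 * C * d)| ≤ |Real.sin (b - a)| / 2 * (A + B) := by
    rw [abs_mul]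
    refine mul_le_mul ?_ h1 (abs_nonneg _) (by positivity)
    rw [abs_div, abs_of_pos (by positivity : (0 : ℝ) < 2 * n), div_le_div_iff₀ (by positivity)
      two_pos]
    have := abs_sin_nat_mul_le n (b - a)
    rw [← hS] at this
    linarith
  have h4 := (abs_le.1 h3).1
  linarith

section
variable {𝕜 : Type*} [RCLike 𝕜]

/-! ### The squared modulus of a combination of two waves. -/

theorem norm_add_mul_sq (α β : 𝕜) (x y : ℝ) :
    ‖α * (x : 𝕜) + β * (y : 𝕜)‖ ^ 2
      = ‖α‖ ^ 2 * x ^ 2 + ‖β‖ ^ 2 * y ^ 2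
        + 2 * (RCLike.re α * RCLike.re β + RCLike.im α * RCLike.im β) * (x * y) := by
  simp only [← RCLike.normSq_eq_def', RCLike.normSq_apply, map_add, RCLike.re_mul_ofReal,
    RCLike.im_mul_ofReal]
  ring

theorem wave_neg_pi_div_two_coe (n : ℕ) (y : ℝ) :
    wave n (-(Real.pi / 2)) (y : AddCircle (2 * Real.pi)) = Real.sin (n * y) := by
  rw [wave_coe, ← sub_eq_add_neg, Real.cos_sub_pi_div_two]

/-- The squared modulus of `α cos (n y) + β sin (n y)`. -/
def waveSq (n : ℕ) (α β : 𝕜) (y : AddCircle (2 * Real.pi)) : ℝ :=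
  ‖α * ((wave n 0 y : ℝ) : 𝕜) + β * ((wave n (-(Real.pi / 2)) y : ℝ) : 𝕜)‖ ^ 2

theorem continuous_waveSq (n : ℕ) (α β : 𝕜) : Continuous (waveSq n α β) := by
  unfold waveSq
  fun_prop

theorem integrable_waveSq (n : ℕ) (α β : 𝕜) : Integrable (waveSq n α β) :=
  (continuous_waveSq n α β).integrable_of_hasCompactSupport
    (HasCompactSupport.of_compactSpace _)

/-- Cauchy-Schwarz for α and β viewed as real vectors of the plane. It provides the hypothesis C² ≤
AB of `integral_trig_ge`. -/
theorem inner_sq_le (α β : 𝕜) :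
    (RCLike.re α * RCLike.re β + RCLike.im α * RCLike.im β) ^ 2 ≤ ‖α‖ ^ 2 * ‖β‖ ^ 2 := by
  rw [← RCLike.normSq_eq_def', ← RCLike.normSq_eq_def', RCLike.normSq_apply, RCLike.normSq_apply]
  nlinarith [sq_nonneg (RCLike.re α * RCLike.im β - RCLike.im α * RCLike.re β)]

theorem waveSq_coe (n : ℕ) (α β : 𝕜) (y : ℝ) :
    waveSq n α β (y : AddCircle (2 * Real.pi))
      = ‖α‖ ^ 2 * Real.cos (n * y) ^ 2 + ‖β‖ ^ 2 * Real.sin (n * y) ^ 2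
        + 2 * (RCLike.re α * RCLike.re β + RCLike.im α * RCLike.im β)
          * (Real.cos (n * y) * Real.sin (n * y)) := by
  rw [waveSq, wave_neg_pi_div_two_coe, wave_coe, add_zero, norm_add_mul_sq]

theorem waveSq_le (n : ℕ) (α β : 𝕜) (y : AddCircle (2 * Real.pi)) :
    waveSq n α β y ≤ ‖α‖ ^ 2 + ‖β‖ ^ 2 := by
  induction y using QuotientAddGroup.induction_on with
  | H y =>
    refine (waveSq_coe n α β y).trans_le ?_
    set C := RCLike.re α * RCLike.re β + RCLike.im α * RCLike.im β
    have h1 := Real.sin_sq_add_cos_sq ((n : ℝ) * y)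
    set x := Real.cos (n * y)
    set z := Real.sin (n * y)
    have h2 : |C| ≤ ‖α‖ * ‖β‖ := by
      refine abs_le_of_sq_le_sq ?_ (by positivity)
      rw [mul_pow]
      exact inner_sq_le α β
    have h3 : C * (x * z) ≤ ‖α‖ * ‖β‖ * (|x| * |z|) := by
      rw [← abs_mul]
      exact (le_abs_self _).trans ((abs_mul _ _).trans_le
        (mul_le_mul_of_nonneg_right h2 (abs_nonneg _)))
    rw [← sq_abs x, ← sq_abs z] at h1 ⊢
    nlinarith [sq_nonneg (‖α‖ * |z| - ‖β‖ * |x|)]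

theorem integral_waveSq_le (n : ℕ) (α β : 𝕜) :
    ∫ y, waveSq n α β y ≤ 2 * Real.pi * (‖α‖ ^ 2 + ‖β‖ ^ 2) := by
  refine (integral_mono (integrable_waveSq n α β) (integrable_const _)
    (waveSq_le n α β)).trans_eq ?_
  rw [integral_const, smul_eq_mul, measureReal_def, AddCircle.measure_univ,
    ENNReal.toReal_ofReal Real.two_pi_pos.le]

/-! ### Arcs of the circle and lower bounds over them. -/

/-- The arc that is the image of an interval. -/
def arc (a b : ℝ) : Set (AddCircle (2 * Real.pi)) := (fun y : ℝ => (y : AddCircle _)) '' Set.Ioo a b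

theorem measurableSet_arc (a b : ℝ) : MeasurableSet (arc a b) :=
  (QuotientAddGroup.isOpenMap_coe _ isOpen_Ioo).measurableSet

theorem strip_eq (a b : ℝ) : strip a b = Set.univ ×ˢ arc a b := by
  ext ⟨x, y⟩
  constructor
  · rintro ⟨q, hq, h⟩
    exact ⟨Set.mem_univ _, q.2, hq, congrArg Prod.snd h⟩
  · rintro ⟨-, t, ht, h⟩
    exact ⟨(x, t), ht, Prod.ext rfl h⟩

/-- The interval may be longer than a period, so that its image covers points several times. Cutting
at b' ≤ a + 2π keeps it inside the fundamental domain ]a, a + 2π], where positivity of f gives the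
comparison. -/
theorem setIntegral_arc_ge {f : AddCircle (2 * Real.pi) → ℝ} (hf : Integrable f)
    (h0 : ∀ y, 0 ≤ f y) {a b b' : ℝ} (hab : a ≤ b') (hb : b' ≤ b) (hb' : b' ≤ a + 2 * Real.pi) :
    ∫ y in a..b', f y ≤ ∫ y in arc a b, f y := by
  rw [← integral_indicator (measurableSet_arc a b), ← AddCircle.integral_preimage (2 * Real.pi) a,
    intervalIntegral.integral_of_le hab, integral_Ioc_eq_integral_Ioo]
  have h1 : ∀ y ∈ Set.Ioo a b', f y = (arc a b).indicator f y := fun y hy => by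
    rw [Set.indicator_of_mem]
    exact ⟨y, ⟨hy.1, hy.2.trans_le hb⟩, rfl⟩
  rw [setIntegral_congr_fun measurableSet_Ioo h1]
  refine setIntegral_mono_set ?_ (Filter.Eventually.of_forall fun y =>
    Set.indicator_nonneg (fun z _ => h0 z) _) (Filter.Eventually.of_forall fun y hy =>
      ⟨hy.1, hy.2.le.trans hb'⟩)
  have h2 := (AddCircle.measurePreserving_mk (2 * Real.pi) a).integrable_comp_of_integrable
    (hf.indicator (measurableSet_arc a b))
  exact h2

theorem integral_waveSq_arc_ge {n : ℕ} (hn : 0 < n) (α β : 𝕜) {a b b' : ℝ} (hab : a ≤ b')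
    (hb : b' ≤ b) (hb' : b' ≤ a + 2 * Real.pi) :
    (‖α‖ ^ 2 + ‖β‖ ^ 2) * ((b' - a - |Real.sin (b' - a)|) / 2)
      ≤ ∫ y in arc a b, waveSq n α β y := by
  refine le_trans ?_ (setIntegral_arc_ge (integrable_waveSq n α β)
    (fun y => sq_nonneg _) hab hb hb')
  simp only [waveSq_coe]
  exact integral_trig_ge hn (sq_nonneg _) (sq_nonneg _) (inner_sq_le α β) a b'

/-! ### Norms of combinations of two modes -/

theorem toReal_eLpNorm_two_sq {α F : Type*} [MeasurableSpace α] [NormedAddCommGroup F]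
    {μ : Measure α} {f : α → F} (hf : MemLp f 2 μ) :
    (eLpNorm f 2 μ).toReal ^ 2 = ∫ x, ‖f x‖ ^ 2 ∂μ := by
  rw [hf.eLpNorm_eq_integral_rpow_norm two_ne_zero ENNReal.ofNat_ne_top]
  simp only [ENNReal.toReal_ofNat, Real.rpow_ofNat]
  have h : 0 ≤ ∫ x, ‖f x‖ ^ 2 ∂μ := integral_nonneg fun x => by positivity
  rw [ENNReal.toReal_ofReal (Real.rpow_nonneg h _), ← Real.rpow_natCast, ← Real.rpow_mul h]
  norm_num

/-- Both modes share the factor f(x), so the integral splits by Fubini. Since the factor in x does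
not depend on S, it drops out when the cylinder is compared with a strip. -/
theorem norm_sq_modes {f : ℝ → ℝ} (hf : MemLp f 2) (n : ℕ) (α β : 𝕜)
    (S : Set (AddCircle (2 * Real.pi))) :
    (eLpNorm (α • mode 𝕜 hf n 0 + β • mode 𝕜 hf n (-(Real.pi / 2)) : L2X 𝕜) 2
      (volume.restrict (Set.univ ×ˢ S))).toReal ^ 2
      = (∫ x, f x ^ 2) * ∫ y in S, waveSq n α β y := by
  rw [toReal_eLpNorm_two_sq ((Lp.memLp _).restrict _)]
  have h1 : (fun p => ‖(α • mode 𝕜 hf n 0 + β • mode 𝕜 hf n (-(Real.pi / 2)) : L2X 𝕜) p‖ ^ 2)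
      =ᵐ[volume] fun p => f p.1 ^ 2 * waveSq n α β p.2 := by
    filter_upwards [coeFn_mode (𝕜 := 𝕜) hf n 0, coeFn_mode (𝕜 := 𝕜) hf n (-(Real.pi / 2)),
      Lp.coeFn_add (α • mode 𝕜 hf n 0) (β • mode 𝕜 hf n (-(Real.pi / 2))),
      Lp.coeFn_smul α (mode 𝕜 hf n 0), Lp.coeFn_smul β (mode 𝕜 hf n (-(Real.pi / 2)))]
      with p e1 e2 e3 e4 e5
    rw [e3, Pi.add_apply, e4, e5, Pi.smul_apply, Pi.smul_apply, e1, e2, waveSq]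
    have h2 : α • ((tensor f (wave n 0) p : ℝ) : 𝕜)
        + β • ((tensor f (wave n (-(Real.pi / 2))) p : ℝ) : 𝕜)
        = ((f p.1 : ℝ) : 𝕜) * (α * ((wave n 0 p.2 : ℝ) : 𝕜)
          + β * ((wave n (-(Real.pi / 2)) p.2 : ℝ) : 𝕜)) := by
      simp only [tensor, smul_eq_mul, RCLike.ofReal_mul]
      ring
    rw [h2, norm_mul, mul_pow, RCLike.norm_ofReal, sq_abs]
  rw [integral_congr_ae (ae_restrict_of_ae h1), Measure.volume_eq_prod,
    setIntegral_prod_mul (fun x => f x ^ 2) (waveSq n α β), Measure.restrict_univ]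

/-! ### Structure of the eigenspaces -/

/-- Every eigenspace is two-dimensional, spanned by two product functions. -/
theorem exists_modes {s : ℝ} (hs : Irrational (s ^ 2)) {E : 𝕜} (hE : IsEigenvalue (P 𝕜 s) E) :
    Module.finrank 𝕜 (eigenspace (P 𝕜 s) E) = 2 ∧
      ∃ (n : ℕ) (f : ℝ → ℝ) (hf : MemLp f 2 volume), 0 < n ∧ 0 < ∫ x, f x ^ 2 ∧
        ∀ u ∈ eigenspace (P 𝕜 s) E, ∃ α β : 𝕜,
          (u : L2X 𝕜) = (α • mode 𝕜 hf n 0 + β • mode 𝕜 hf n (-(Real.pi / 2)) : L2X 𝕜) := by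
  obtain ⟨n, k, hn, rfl⟩ := hE.eq_level
  have hc : (0 : ℝ) < n := Nat.cast_pos.2 hn
  obtain ⟨p, hp, hode⟩ := exists_hermite_function hn s k
  have hf := memLp_polyGauss hc p
  have hpos := integral_polyGauss_sq_pos hc hp
  have hmem := fun θ => mode_mem_eigenspace (𝕜 := 𝕜) (V := potential s) (contDiff_polyGauss n p) hf
    (memLp_deriv_deriv_polyGauss hc p) (memLp_potential_mul_polyGauss hc s p) hn θ hode
  obtain ⟨v, hv⟩ : ∃ v : eigenspace (P 𝕜 s) (level s n k : 𝕜),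
      ((v : L20 𝕜) : L2X 𝕜) = mode 𝕜 hf n 0 := ⟨⟨_, hmem 0⟩, rfl⟩
  obtain ⟨w, hw⟩ : ∃ w : eigenspace (P 𝕜 s) (level s n k : 𝕜),
      ((w : L20 𝕜) : L2X 𝕜) = mode 𝕜 hf n (-(Real.pi / 2)) := ⟨⟨_, hmem _⟩, rfl⟩
  have hcomb : ∀ α β : 𝕜, (((α • v + β • w : eigenspace (P 𝕜 s) (level s n k : 𝕜)) : L20 𝕜)
      : L2X 𝕜) = α • mode 𝕜 hf n 0 + β • mode 𝕜 hf n (-(Real.pi / 2)) := fun α β => by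
    rw [← hv, ← hw]
    simp only [Submodule.coe_add, Submodule.coe_smul]
  obtain ⟨hfin, hle⟩ := finrank_eigenspace_le (𝕜 := 𝕜) hs hn k
  have hli : LinearIndependent 𝕜 ![v, w] := by
    refine LinearIndependent.pair_iff.2 fun α β h0 => ?_
    have h1 : α • mode 𝕜 hf n 0 + β • mode 𝕜 hf n (-(Real.pi / 2)) = 0 :=
      by rw [← hcomb, h0, ZeroMemClass.coe_zero, ZeroMemClass.coe_zero]
    -- Linear independence follows from the arc estimate itself: a vanishing combination has zero
    -- mass over the arc of ]0, 1[, while |sin 1| < 1 makes the lower bound a positive multiple of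
    -- ‖α‖² + ‖β‖².
    have h2 := norm_sq_modes hf n α β (arc 0 1)
    rw [h1, eLpNorm_congr_ae (ae_restrict_of_ae (Lp.coeFn_zero 𝕜 2 volume)), eLpNorm_zero,
      ENNReal.toReal_zero, zero_pow two_ne_zero] at h2
    have h3 := (mul_eq_zero.1 h2.symm).resolve_left hpos.ne'
    have h4 := integral_waveSq_arc_ge hn α β zero_lt_one.le le_rfl
      (show (1 : ℝ) ≤ 0 + 2 * Real.pi by linarith [Real.pi_gt_three])
    have h5 := Real.abs_sin_lt_abs (one_ne_zero (α := ℝ))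
    rw [abs_one] at h5
    rw [h3, sub_zero] at h4
    have h6 : ‖α‖ ^ 2 + ‖β‖ ^ 2 ≤ 0 := nonpos_of_mul_nonpos_left h4 (by linarith)
    constructor
    · exact norm_eq_zero.1 (pow_eq_zero_iff two_ne_zero |>.1
        (le_antisymm (by linarith [sq_nonneg ‖β‖]) (sq_nonneg _)))
    · exact norm_eq_zero.1 (pow_eq_zero_iff two_ne_zero |>.1
        (le_antisymm (by linarith [sq_nonneg ‖α‖]) (sq_nonneg _)))
  have hrank : Module.finrank 𝕜 (eigenspace (P 𝕜 s) (level s n k : 𝕜)) = 2 :=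
    le_antisymm hle (by simpa using hli.fintype_card_le_finrank)
  refine ⟨hrank, n, _, hf, hn, hpos, fun u hu => ?_⟩
  have hspan := hli.span_eq_top_of_card_eq_finrank' (by rw [hrank, Fintype.card_fin])
  have hu' : (⟨u, hu⟩ : eigenspace (P 𝕜 s) (level s n k : 𝕜)) ∈ Submodule.span 𝕜 (Set.range ![v, w]) := by
    rw [hspan]
    exact Submodule.mem_top
  rw [Submodule.mem_span_range_iff_exists_fun] at hu'
  obtain ⟨r, hr⟩ := hu'
  refine ⟨r 0, r 1, ?_⟩
  rw [Fin.sum_univ_two] at hr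
  rw [← hcomb]
  exact (congrArg (fun z => ((Subtype.val z : L20 𝕜) : L2X 𝕜)) hr).symm

end

end Grushin

end

/-! ### Multiplicity two and concentration on strips. -/

theorem mainTheorem8 {𝕜 : Type*} [RCLike 𝕜] (s : ℝ) (hs : Irrational (s ^ 2)) :
    (∀ E : 𝕜, Grushin.IsEigenvalue (Grushin.P 𝕜 s) E →
      Module.finrank 𝕜 (Grushin.eigenspace (Grushin.P 𝕜 s) E) = 2) ∧
    (∀ a b : ℝ, a < b → ∃ C : ℝ, 0 < C ∧
      ∀ E : 𝕜, ∀ u ∈ Grushin.eigenspace (Grushin.P 𝕜 s) E,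
        ‖(u : Grushin.L2X 𝕜)‖ ≤
          C * (eLpNorm (u : Grushin.L2X 𝕜) 2 (volume.restrict (Grushin.strip a b))).toReal) := by
  refine ⟨fun E hE => (Grushin.exists_modes hs hE).1, fun a b hab => ?_⟩
  -- At most one turn of the circle is used, as b - a may exceed 2π.
  set b' := min b (a + 2 * Real.pi) with hb'
  have hab' : a < b' := lt_min hab (by linarith [Real.two_pi_pos])
  set κ := (b' - a - |Real.sin (b' - a)|) / 2 with hκ
  have hκ0 : 0 < κ := by
    have := Real.abs_sin_lt_abs (sub_pos.2 hab').ne'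
    rw [abs_of_pos (sub_pos.2 hab')] at this
    linarith
  -- The square of C is the ratio of the upper bound 2π(‖α‖² + ‖β‖²) on the circle to the lower
  -- bound κ(‖α‖² + ‖β‖²) on the arc; neither factor depends on n or E.
  refine ⟨Real.sqrt (2 * Real.pi / κ), Real.sqrt_pos.2 (div_pos Real.two_pi_pos hκ0),
    fun E u hu => ?_⟩
  -- E need not be an eigenvalue; a nonzero u makes it one, and the description of its eigenspace
  -- then applies.
  by_cases h0 : u = 0
  · rw [h0, ZeroMemClass.coe_zero, norm_zero]
    positivity
  obtain ⟨-, n, f, hf, hn, hpos, hspan⟩ := Grushin.exists_modes hs ⟨u, hu, h0⟩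
  obtain ⟨α, β, huv⟩ := hspan u hu
  have h1 := Grushin.norm_sq_modes hf n α β Set.univ
  have h2 := Grushin.norm_sq_modes hf n α β (Grushin.arc a b)
  rw [Set.univ_prod_univ, Measure.restrict_univ, Measure.restrict_univ, ← huv, ← Lp.norm_def] at h1
  rw [← Grushin.strip_eq, ← huv] at h2
  have h3 := Grushin.integral_waveSq_le n α β
  have h4 : (‖α‖ ^ 2 + ‖β‖ ^ 2) * κ ≤ ∫ y in Grushin.arc a b, Grushin.waveSq n α β y :=
    Grushin.integral_waveSq_arc_ge hn α β hab'.le (min_le_left _ _) (min_le_right _ _)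
  refine abs_le_of_sq_le_sq' ?_ (by positivity) |>.2
  rw [mul_pow, Real.sq_sqrt (div_pos Real.two_pi_pos hκ0).le, h1, h2]
  calc _ ≤ (∫ x, f x ^ 2) * (2 * Real.pi * (‖α‖ ^ 2 + ‖β‖ ^ 2)) :=
        mul_le_mul_of_nonneg_left h3 hpos.le
    _ = 2 * Real.pi / κ * ((∫ x, f x ^ 2) * ((‖α‖ ^ 2 + ‖β‖ ^ 2) * κ)) := by
        field_simp
    _ ≤ _ := by gcongr
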